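/- For $w>0$ let $\mathcal L_w=-\frac{d^2}{dx^2}+w^2x^2$ on $(-1,1)$ with Dirichlet boundary conditions. Let $\lambda(w)$ be its least eigenvalue, let $\nu(w)$ be defined by $\lambda(w)=w(1+\nu(w))$, and let $p(w,\cdot)$ be the real eigenfunction for $\lambda(w)$ with $\|p(w,\cdot)\|_{L^2(-1,1)}=1$ and $p(w,0)>0$. For $m\in\mathbb N$ and $t,y\in\mathbb R$ put $\Phi_m(t,y,w)=wy-\lambda(w)t-2\pi m w$. Proposition. There exist $w_0>0$, constants $C_0,C,c>0$, and positive constants $A_k,C_k$ depending only on $k$, such that for all $w\ge w_0$ the least eigenvalue $\lambda(w)$ and the eigenfunction $p(w,\cdot)$ exist, $\lambda$ is $C^\infty$ at $w$, the function $p(\cdot,x)$ is $C^2$ at $w$ for every $|x|\le\frac12$, and 1. $|\lambda(w)-w|\le C_0w^{3/2}e^{-w}$, and $|\nu^{(k)}(w)|\le C_kw^{A_k}e^{-w}$ for all $k\ge 0$; 2. $|\lambda^{(k)}(w)|\le C_kw^{A_k}e^{-w}$ for all $k\ge 2$; 3. $\left|\frac{\partial^k\Phi_m}{\partial w^k}(t,y,w)\right|\le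 C_0(1+|t|)w^{A_k}e^{-w}$ for all $k\ge2$, $t,y\in\mathbb R$, $m\in\mathbb N$; 4. for all $|x|\le\frac12$: $c\,w^{1/4}e^{-wx^2/2}\le|p(w,x)|\le w^{1/4}e^{-wx^2/2}$, and $\left|\frac{\partial^kp}{\partial w^k}(w,x)\right|\le C\,w^{\frac14-k}$ for $k=1,2$; 5. $|p(w,x)|\le e^{-w/10}$ for all $\frac12<|x|\le1$. -/

import Mathlib

open scoped ContDiff

/-- `u` is a (classical, real-valued) eigenfunction, with eigenvalue `E`, of the harmonic
oscillator `-d²/dx² + w² x²` on `(-1,1)` with Dirichlet boundary conditions. Only the values of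
`u` on `[-1,1]` matter. -/
structure IsDirichletEigenfunction (w E : ℝ) (u : ℝ → ℝ) : Prop where
  continuousOn : ContinuousOn u (Set.Icc (-1) 1)
  contDiffOn : ContDiffOn ℝ 2 u (Set.Ioo (-1) 1)
  eigen : ∀ x ∈ Set.Ioo (-1 : ℝ) 1, -deriv (deriv u) x + w ^ 2 * x ^ 2 * u x = E * u x
  left : u (-1) = 0
  right : u 1 = 0
  nonzero : ∃ x ∈ Set.Ioo (-1 : ℝ) 1, u x ≠ 0

/-- The set of Dirichlet eigenvalues of `-d²/dx² + w² x²` on `(-1,1)`. -/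
def dirichletEigenvalues (w : ℝ) : Set ℝ :=
  {E | ∃ u : ℝ → ℝ, IsDirichletEigenfunction w E u}

/-- `λ(w)`, the first (least) Dirichlet eigenvalue. -/
noncomputable def firstEigenvalue (w : ℝ) : ℝ := sInf (dirichletEigenvalues w)

/-- `ν(w)`, defined by `λ(w) = w (1 + ν(w))`. -/
noncomputable def eigenvalueDefect (w : ℝ) : ℝ := firstEigenvalue w / w - 1

/-- `u` is an eigenfunction for the first eigenvalue, has norm one in `L²(-1,1)`, and its sign is
fixed by `u(0) > 0`. This determines `u` on `[-1,1]`. -/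
structure IsFirstEigenfunction (w : ℝ) (u : ℝ → ℝ) : Prop where
  eigenfunction : IsDirichletEigenfunction w (firstEigenvalue w) u
  norm_one : ∫ x in (-1 : ℝ)..1, u x ^ 2 = 1
  pos_zero : 0 < u 0

/-- `p(w, ·)`, the first normalized eigenfunction. -/
noncomputable def firstEigenfunction (w : ℝ) : ℝ → ℝ :=
  Classical.epsilon (IsFirstEigenfunction w)

/-- The phase `Φ_m(t,y,w) = w y - λ(w) t - 2 π m w`. -/
noncomputable def phase (m : ℕ) (t y w : ℝ) : ℝ :=
  w * y - firstEigenvalue w * t - 2 * Real.pi * m * w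

/-! The even solution of `-u'' + w² x² u = w (1 - 4a) u` with `u(0) = 1` is `exp(-w x²/2) M(a, 1/2,
w x²)`. Writing `M = 1 + a Q`, with `Q` the function `kummerQuot`, the boundary condition becomes `1
+ a Q(a, w) = 0`, that is `a = -1 / Q(a, w)`. Since `Q(0, w)` has size at least `e^w / (3 √w)`
(`exp_le_sqrt_mul_kummerQuot`), the map `a ↦ -1 / Q(a, w)` contracts a disc of radius `2 / Q(0, w)`,
and its fixed point `a` is negative of size `√w e^{-w}`.

For this `a` the solution is positive on `(-1, 1)` and vanishes at `±1`. Jacobi's argument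
(`IsDirichletEigenfunction.eq_of_le_of_positive`) shows that it is the ground state and that the
eigenvalue is simple; hence `λ = w (1 - 4a)` and `ν = -4a`. Positivity of the Taylor coefficients of
`Q` gives `1 - x² ≤ 1 + a Q(a, w x²) ≤ 1`, so the ground state is squeezed between two Gaussians,
which yields the pointwise bounds.

For derivatives in `w`, the iteration runs equally well at complex `z` in a disc of radius `1/8`
about `w`. The root is holomorphic there with the same exponential bound, and Cauchy's estimate
bounds every derivative of `ν` and `λ`. The phase is affine in `w` apart from `-λ t`, so it inherits
these bounds.

Cauchy's estimate on a disc of fixed radius would not gain the powers `w^{-k}` needed for the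
eigenfunction. It is therefore split as a normalized Gaussian plus a remainder: the Gaussian extends
to a disc of radius `w/40`, which gives the gain, while for `|x| ≤ 1/2` the remainder is so small on
the disc of radius `1/8` that nothing needs to be gained
(`IsGaussianFrequency.abs_iteratedDeriv_firstEigenfunction_le`). -/

/-- The Taylor coefficients in `z` of `(M(a, 1/2, z) - 1) / a`, where `M` is Kummer's function. -/
def kummerCoeff {𝕜 : Type*} [RCLike 𝕜] (a : 𝕜) : ℕ → 𝕜
  | 0 => 0
  | 1 => 2
  | n + 2 => (n + 1 + a) / ((n + 2) * (n + 3 / 2)) * kummerCoeff a (n + 1)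

/-- The entire function `(M(a, 1/2, z) - 1) / a`, where `M` is Kummer's function. -/
noncomputable def kummerQuot {𝕜 : Type*} [RCLike 𝕜] (a z : 𝕜) : 𝕜 :=
  ∑' n, kummerCoeff a n * z ^ n

/-- The termwise `z`-derivative of `kummerQuot`. -/
noncomputable def kummerQuotDeriv {𝕜 : Type*} [RCLike 𝕜] (a z : 𝕜) : 𝕜 :=
  ∑' n : ℕ, ((n + 1 : 𝕜) * kummerCoeff a (n + 1)) * z ^ n

/-- The termwise second `z`-derivative of `kummerQuot`. -/
noncomputable def kummerQuotDeriv2 {𝕜 : Type*} [RCLike 𝕜] (a z : 𝕜) : 𝕜 :=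
  ∑' n : ℕ, ((n + 1 : 𝕜) * ((n + 2 : 𝕜) * kummerCoeff a (n + 2))) * z ^ n

/-! ### Power series with factorially decaying coefficients -/

section ExponentialType

variable {𝕜 : Type*} [RCLike 𝕜]

theorem summable_of_norm_le_factorial {c : ℕ → 𝕜} {C B : ℝ}
    (h : ∀ n, ‖c n‖ ≤ C * (B ^ n / n.factorial)) (z : 𝕜) : Summable fun n => c n * z ^ n := by
  refine Summable.of_norm_bounded ((Real.summable_pow_div_factorial (B * ‖z‖)).mul_left C) ?_
  intro n
  rw [norm_mul, norm_pow, mul_pow]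
  calc ‖c n‖ * ‖z‖ ^ n ≤ C * (B ^ n / n.factorial) * ‖z‖ ^ n := by gcongr; exact h n
    _ = _ := by ring

theorem hasDerivAt_tsum_mul_pow {c : ℕ → 𝕜} {C B : ℝ}
    (h : ∀ n, ‖c n‖ ≤ C * (B ^ n / n.factorial)) (z : 𝕜) :
    HasDerivAt (fun z => ∑' n, c n * z ^ n)
      (∑' n : ℕ, ((n + 1 : 𝕜) * c (n + 1)) * z ^ n) z := by
  set R := ‖z‖ + 1 with hR
  have hR0 : 0 < R := by positivity
  have hu : Summable fun n : ℕ => C * (B ^ n / n.factorial) * (n * R ^ (n - 1)) := by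
    rw [← summable_nat_add_iff 1]
    refine ((Real.summable_pow_div_factorial (B * R)).mul_left (C * B)).congr ?_
    intro n
    have h1 : ((n + 1).factorial : ℝ) = (n + 1) * n.factorial := by
      rw [Nat.factorial_succ]; push_cast; ring
    rw [h1]
    have : (n.factorial : ℝ) ≠ 0 := by positivity
    have h2 : (n + 1 : ℝ) ≠ 0 := by positivity
    simp only [Nat.add_sub_cancel, mul_pow, pow_succ]
    push_cast
    field_simp
  have hz : z ∈ Metric.ball (0 : 𝕜) R := by
    simp [hR]
  have key := hasDerivAt_tsum_of_isPreconnected (𝕜 := 𝕜) (F := 𝕜) (g := fun n z => c n * z ^ n)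
    (g' := fun n z => c n * (n * z ^ (n - 1))) hu Metric.isOpen_ball
    (convex_ball (0 : 𝕜) R).isPreconnected ?_ ?_ hz
    (summable_of_norm_le_factorial h z) hz
  · have hs : Summable fun n : ℕ => c n * (n * z ^ (n - 1)) := by
      refine Summable.of_norm_bounded hu fun n => ?_
      rw [norm_mul, norm_mul, norm_pow, RCLike.norm_natCast]
      have hzR : ‖z‖ ≤ R := by rw [hR]; linarith
      exact mul_le_mul (h n) (by gcongr) (by positivity) ((norm_nonneg _).trans (h n))
    have e : ∑' n : ℕ, c n * (n * z ^ (n - 1)) =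
        ∑' n : ℕ, ((n + 1 : 𝕜) * c (n + 1)) * z ^ n := by
      rw [hs.tsum_eq_zero_add]
      simp only [Nat.cast_zero, zero_mul, mul_zero, zero_add, Nat.add_sub_cancel]
      refine tsum_congr fun n => ?_
      push_cast; ring
    rw [← e]
    exact key
  · intro n y _
    exact (hasDerivAt_pow n y).const_mul (c n)
  · intro n y hy
    have hy' : ‖y‖ ≤ R := by simpa using (mem_ball_zero_iff.1 hy).le
    rw [norm_mul, norm_mul, norm_pow, RCLike.norm_natCast]
    exact mul_le_mul (h n) (by gcongr) (by positivity) ((norm_nonneg _).trans (h n))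

end ExponentialType

/-! ### Kummer coefficients and their majorants -/

theorem kummerCoeff_succ_succ {𝕜 : Type*} [RCLike 𝕜] (a : 𝕜) (n : ℕ) :
    kummerCoeff a (n + 2) = (n + 1 + a) / ((n + 2) * (n + 3 / 2)) * kummerCoeff a (n + 1) := rfl

theorem succ_mul_kummerCoeff {𝕜 : Type*} [RCLike 𝕜] (a : 𝕜) (n : ℕ) :
    (n + 2) * (n + 3 / 2) * kummerCoeff a (n + 2) = (n + 1 + a) * kummerCoeff a (n + 1) := by
  have e1 : (n + 2 : 𝕜) ≠ 0 := by exact_mod_cast (show n + 2 ≠ 0 by omega)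
  have e2 : (n + 3 / 2 : 𝕜) ≠ 0 := by
    have : (2 * n + 3 : 𝕜) ≠ 0 := by exact_mod_cast (show 2 * n + 3 ≠ 0 by omega)
    intro h
    apply this
    linear_combination 2 * h
  rw [kummerCoeff_succ_succ, ← mul_assoc, mul_div_cancel₀ _ (mul_ne_zero e1 e2)]

theorem kummerCoeff_ofReal (a : ℝ) (n : ℕ) :
    ((kummerCoeff a n : ℝ) : ℂ) = kummerCoeff (a : ℂ) n := by
  induction n with
  | zero => simp [kummerCoeff]
  | succ n ih =>
    cases n with
    | zero => simp [kummerCoeff]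
    | succ n =>
      rw [kummerCoeff_succ_succ, kummerCoeff_succ_succ, ← ih]
      push_cast; ring

theorem kummerQuot_ofReal (a z : ℝ) :
    ((kummerQuot a z : ℝ) : ℂ) = kummerQuot (a : ℂ) (z : ℂ) := by
  simp only [kummerQuot, Complex.ofReal_tsum, Complex.ofReal_mul, Complex.ofReal_pow,
    kummerCoeff_ofReal]

theorem kummerCoeff_nonneg {a : ℝ} (ha : -1 < a) (n : ℕ) : 0 ≤ kummerCoeff a n := by
  induction n with
  | zero => simp [kummerCoeff]
  | succ n ih =>
    cases n with
    | zero => simp [kummerCoeff]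
    | succ n =>
      rw [kummerCoeff_succ_succ]
      have : (0 : ℝ) ≤ n := by positivity
      refine mul_nonneg (div_nonneg (by linarith) (by positivity)) ih

/-- The coefficients of `kummerQuot 0`, with the constant term replaced by `2`. -/
noncomputable def kummerMajorant (n : ℕ) : ℝ := if n = 0 then 2 else kummerCoeff (0 : ℝ) n

theorem kummerCoeff_zero_nonneg (n : ℕ) : 0 ≤ kummerCoeff (0 : ℝ) n :=
  kummerCoeff_nonneg (by norm_num) n

theorem kummerCoeff_zero_le_majorant (n : ℕ) : kummerCoeff (0 : ℝ) n ≤ kummerMajorant n := by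
  unfold kummerMajorant
  split_ifs with h
  · subst h; simp [kummerCoeff]
  · rfl

/-- For positive index the ratio is `(n + 1) / (n + 3/2)`, at most one. Index zero forces the
constant term `2` of the majorant. This is the coefficient form of `Q' ≤ 2 + Q` at `a = 0`. -/
theorem succ_mul_kummerCoeff_zero_le (n : ℕ) :
    (n + 1) * kummerCoeff (0 : ℝ) (n + 1) ≤ kummerMajorant n := by
  cases n with
  | zero => simp [kummerCoeff, kummerMajorant]
  | succ n =>
    simp only [kummerMajorant, Nat.add_eq_zero_iff, one_ne_zero, and_false, if_false]
    rw [kummerCoeff_succ_succ, ← mul_assoc]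
    have h0 := kummerCoeff_zero_nonneg (n + 1)
    refine mul_le_of_le_one_left h0 ?_
    push_cast
    rw [← mul_div_assoc, div_le_one (by positivity)]
    have : (0 : ℝ) ≤ n := by positivity
    nlinarith

theorem succ_mul_kummerMajorant_le (n : ℕ) :
    (n + 1) * kummerMajorant (n + 1) ≤ kummerMajorant n := by
  simpa [kummerMajorant] using succ_mul_kummerCoeff_zero_le n

theorem kummerMajorant_le (n : ℕ) : kummerMajorant n ≤ 2 / n.factorial := by
  induction n with
  | zero => simp [kummerMajorant]
  | succ n ih =>
    have h := (succ_mul_kummerMajorant_le n).trans ih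
    rw [Nat.factorial_succ]
    push_cast
    rw [le_div_iff₀ (by positivity)]
    rw [le_div_iff₀ (by positivity)] at h
    linarith

section Bounds

variable {𝕜 : Type*} [RCLike 𝕜]

theorem norm_natCast_add_one_add_le (n : ℕ) (a : 𝕜) : ‖(n + 1 + a : 𝕜)‖ ≤ n + 1 + ‖a‖ := by
  refine (norm_add_le _ _).trans ?_
  have : ‖(n + 1 : 𝕜)‖ = n + 1 := by
    rw [← Nat.cast_succ, RCLike.norm_natCast]; push_cast; ring
  rw [this]

theorem norm_kummer_denominator (n : ℕ) :
    ‖((n + 2 : 𝕜) * (n + 3 / 2))‖ = (n + 2) * (n + 3 / 2 : ℝ) := by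
  have : ((n + 2 : 𝕜) * (n + 3 / 2)) = (((n + 2) * (n + 3 / 2 : ℝ) : ℝ) : 𝕜) := by
    push_cast; ring
  rw [this, RCLike.norm_ofReal, abs_of_nonneg (by positivity)]

/-- Replacing `n + 1 + a` by `n + 2` costs the factor `(n + 2) / (n + 1)` against `a = 0`; the
product of these telescopes. The factor `n` is later absorbed by a `z`-derivative, so everything is
compared with `Q(0, ·)`. -/
theorem norm_kummerCoeff_le {a : 𝕜} (ha : ‖a‖ ≤ 1) (n : ℕ) :
    ‖kummerCoeff a n‖ ≤ n * kummerCoeff (0 : ℝ) n := by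
  induction n with
  | zero => simp [kummerCoeff]
  | succ n ih =>
    cases n with
    | zero => simp [kummerCoeff]
    | succ n =>
      rw [kummerCoeff_succ_succ, kummerCoeff_succ_succ, norm_mul, norm_div,
        norm_kummer_denominator]
      have h0 := kummerCoeff_zero_nonneg (n + 1)
      have h1 : ‖(n + 1 + a : 𝕜)‖ ≤ n + 2 := by
        linarith [norm_natCast_add_one_add_le n a]
      calc _ ≤ (n + 2 : ℝ) / ((n + 2) * (n + 3 / 2)) *
            ((n + 1 : ℕ) * kummerCoeff (0 : ℝ) (n + 1)) := by gcongr
        _ = _ := by push_cast; ring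

theorem norm_kummerCoeff_sub_le {a b : 𝕜} (ha : ‖a‖ ≤ 1) (hb : ‖b‖ ≤ 1) (n : ℕ) :
    ‖kummerCoeff a n - kummerCoeff b n‖ ≤ ‖a - b‖ * (n ^ 2 * kummerCoeff (0 : ℝ) n) := by
  induction n with
  | zero => simp [kummerCoeff]
  | succ n ih =>
    cases n with
    | zero => simp [kummerCoeff]
    | succ n =>
      have h0 := kummerCoeff_zero_nonneg (n + 1)
      have h1 : ‖(n + 1 + a : 𝕜)‖ ≤ n + 2 := by
        linarith [norm_natCast_add_one_add_le n a]
      have h2 := norm_kummerCoeff_le hb (n + 1)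
      have e : kummerCoeff a (n + 2) - kummerCoeff b (n + 2) =
          ((n + 1 + a) * (kummerCoeff a (n + 1) - kummerCoeff b (n + 1)) +
            (a - b) * kummerCoeff b (n + 1)) / ((n + 2) * (n + 3 / 2)) := by
        rw [kummerCoeff_succ_succ, kummerCoeff_succ_succ]; ring
      rw [e, norm_div, norm_kummer_denominator, kummerCoeff_succ_succ]
      have h3 : ‖(n + 1 + a) * (kummerCoeff a (n + 1) - kummerCoeff b (n + 1)) +
            (a - b) * kummerCoeff b (n + 1)‖ ≤
          (n + 2 : ℝ) * (‖a - b‖ * (((n + 1 : ℕ) : ℝ) ^ 2 * kummerCoeff (0 : ℝ) (n + 1))) +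
            ‖a - b‖ * ((n + 1 : ℕ) * kummerCoeff (0 : ℝ) (n + 1)) := by
        refine (norm_add_le _ _).trans ?_
        rw [norm_mul, norm_mul]
        gcongr
      rw [div_le_iff₀ (by positivity)]
      refine h3.trans ?_
      have : (0 : ℝ) ≤ ‖a - b‖ * kummerCoeff (0 : ℝ) (n + 1) := by positivity
      have e2 : ‖a - b‖ * (((n + 1 + 1 : ℕ) : ℝ) ^ 2 * ((n + 1 + 0) / ((n + 2) * (n + 3 / 2)) *
          kummerCoeff (0 : ℝ) (n + 1))) * ((n + 2) * (n + 3 / 2)) =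
          (‖a - b‖ * kummerCoeff (0 : ℝ) (n + 1)) * ((n + 2) ^ 2 * (n + 1)) := by
        push_cast; field_simp; ring
      rw [e2]
      push_cast
      have hn : (0 : ℝ) ≤ n := by positivity
      calc _ = (‖a - b‖ * kummerCoeff (0 : ℝ) (n + 1)) * ((n + 2) * (n + 1) ^ 2 + (n + 1)) := by
            ring
        _ ≤ _ := by
            refine mul_le_mul_of_nonneg_left ?_ this
            nlinarith [mul_nonneg hn hn]

theorem norm_kummerCoeff_le_factorial {a : 𝕜} (ha : ‖a‖ ≤ 1) (n : ℕ) :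
    ‖kummerCoeff a n‖ ≤ 2 * (2 ^ n / n.factorial) := by
  refine (norm_kummerCoeff_le ha n).trans ?_
  have h1 : (n : ℝ) * kummerCoeff (0 : ℝ) n ≤ 2 ^ n * (2 / n.factorial) := by
    have h2 := (kummerCoeff_zero_le_majorant n).trans (kummerMajorant_le n)
    have h3 : (n : ℝ) ≤ 2 ^ n := by exact_mod_cast Nat.lt_two_pow_self.le
    exact mul_le_mul h3 h2 (kummerCoeff_zero_nonneg n) (by positivity)
  linarith [show (2 : ℝ) ^ n * (2 / n.factorial) = 2 * (2 ^ n / n.factorial) by ring]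

theorem norm_succ_mul_le_factorial {c : ℕ → 𝕜} {C B : ℝ}
    (h : ∀ n, ‖c n‖ ≤ C * (B ^ n / n.factorial)) (n : ℕ) :
    ‖(n + 1 : 𝕜) * c (n + 1)‖ ≤ (C * B) * (B ^ n / n.factorial) := by
  have h1 : ‖(n + 1 : 𝕜)‖ = n + 1 := by
    rw [← Nat.cast_succ, RCLike.norm_natCast]; push_cast; ring
  rw [norm_mul, h1]
  calc (n + 1 : ℝ) * ‖c (n + 1)‖ ≤ (n + 1) * (C * (B ^ (n + 1) / (n + 1).factorial)) := by
        gcongr; exact h _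
    _ = _ := by
        rw [Nat.factorial_succ, pow_succ]; push_cast; field_simp

theorem hasDerivAt_kummerQuot {a : 𝕜} (ha : ‖a‖ ≤ 1) (z : 𝕜) :
    HasDerivAt (kummerQuot a) (kummerQuotDeriv a z) z :=
  hasDerivAt_tsum_mul_pow (norm_kummerCoeff_le_factorial ha) z

theorem hasDerivAt_kummerQuotDeriv {a : 𝕜} (ha : ‖a‖ ≤ 1) (z : 𝕜) :
    HasDerivAt (kummerQuotDeriv a) (kummerQuotDeriv2 a z) z := by
  have := hasDerivAt_tsum_mul_pow
    (norm_succ_mul_le_factorial (norm_kummerCoeff_le_factorial ha)) z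
  have e : kummerQuotDeriv2 a z = ∑' n : ℕ, ((n + 1 : 𝕜) *
      (((n + 1 : ℕ) + 1 : 𝕜) * kummerCoeff a (n + 1 + 1))) * z ^ n := by
    refine tsum_congr fun n => ?_
    push_cast; ring
  rw [e]
  exact this

theorem summable_kummerQuot {a : 𝕜} (ha : ‖a‖ ≤ 1) (z : 𝕜) :
    Summable fun n => kummerCoeff a n * z ^ n :=
  summable_of_norm_le_factorial (norm_kummerCoeff_le_factorial ha) z

theorem summable_kummerQuotDeriv {a : 𝕜} (ha : ‖a‖ ≤ 1) (z : 𝕜) :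
    Summable fun n : ℕ => ((n + 1 : 𝕜) * kummerCoeff a (n + 1)) * z ^ n :=
  summable_of_norm_le_factorial
    (norm_succ_mul_le_factorial (norm_kummerCoeff_le_factorial ha)) z

theorem summable_kummerQuotDeriv2 {a : 𝕜} (ha : ‖a‖ ≤ 1) (z : 𝕜) :
    Summable fun n : ℕ => ((n + 1 : 𝕜) * ((n + 2 : 𝕜) * kummerCoeff a (n + 2))) * z ^ n := by
  have := summable_of_norm_le_factorial (norm_succ_mul_le_factorial
    (norm_succ_mul_le_factorial (norm_kummerCoeff_le_factorial ha))) z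
  refine this.congr fun n => ?_
  push_cast; ring

theorem hasSum_mul_kummerQuotDeriv {a : 𝕜} (ha : ‖a‖ ≤ 1) (z : 𝕜) :
    HasSum (fun n : ℕ => (n : 𝕜) * kummerCoeff a n * z ^ n) (z * kummerQuotDeriv a z) := by
  have := HasSum.zero_add (f := fun n : ℕ => (n : 𝕜) * kummerCoeff a n * z ^ n)
    (m := z * kummerQuotDeriv a z) (by
      refine ((summable_kummerQuotDeriv ha z).hasSum.mul_left z).congr_fun ?_
      intro n; push_cast; ring)
  simpa using this

theorem hasSum_mul_kummerQuotDeriv2 {a : 𝕜} (ha : ‖a‖ ≤ 1) (z : 𝕜) :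
    HasSum (fun n : ℕ => (n : 𝕜) * ((n + 1) * kummerCoeff a (n + 1)) * z ^ n)
      (z * kummerQuotDeriv2 a z) := by
  have := HasSum.zero_add (f := fun n : ℕ => (n : 𝕜) * ((n + 1) * kummerCoeff a (n + 1)) * z ^ n)
    (m := z * kummerQuotDeriv2 a z) (by
      refine ((summable_kummerQuotDeriv2 ha z).hasSum.mul_left z).congr_fun ?_
      intro n; push_cast; ring)
  simpa using this

/-- Kummer's differential equation. -/
theorem kummerQuot_ode {a : 𝕜} (ha : ‖a‖ ≤ 1) (z : 𝕜) :
    z * kummerQuotDeriv2 a z + (1 / 2 - z) * kummerQuotDeriv a z = 1 + a * kummerQuot a z := by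
  have h0 := (summable_kummerQuot ha z).hasSum
  have h1 := (summable_kummerQuotDeriv ha z).hasSum
  have h1z := hasSum_mul_kummerQuotDeriv ha z
  have h2z := hasSum_mul_kummerQuotDeriv2 ha z
  have hl := (h2z.add (h1.mul_left (1 / 2))).sub (h1z.add (h0.mul_left a))
  have hr : HasSum (fun n : ℕ => if n = 0 then (1 : 𝕜) else 0) 1 := by
    simpa using hasSum_ite_eq (0 : ℕ) (1 : 𝕜)
  have : ∀ n : ℕ, (n : 𝕜) * ((n + 1) * kummerCoeff a (n + 1)) * z ^ n +
      1 / 2 * ((n + 1 : 𝕜) * kummerCoeff a (n + 1) * z ^ n) -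
      ((n : 𝕜) * kummerCoeff a n * z ^ n + a * (kummerCoeff a n * z ^ n)) =
      if n = 0 then (1 : 𝕜) else 0 := by
    intro n
    cases n with
    | zero => simp [kummerCoeff]
    | succ n =>
      have e := succ_mul_kummerCoeff a n
      simp only [Nat.add_eq_zero_iff, one_ne_zero, and_false, if_false]
      push_cast
      linear_combination z ^ (n + 1) * e
  have e := hl.unique (hr.congr_fun this)
  unfold kummerQuot
  unfold kummerQuotDeriv at e ⊢
  linear_combination e

end Bounds

theorem norm_zero_le_one {𝕜 : Type*} [RCLike 𝕜] : ‖(0 : 𝕜)‖ ≤ 1 := by simp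

theorem hasSum_kummerMajorant (s : ℝ) :
    HasSum (fun n => kummerMajorant n * s ^ n) (2 + kummerQuot (0 : ℝ) s) := by
  have h := (hasSum_ite_eq (0 : ℕ) (2 : ℝ)).add
    (summable_kummerQuot (norm_zero_le_one (𝕜 := ℝ)) s).hasSum
  refine h.congr_fun fun n => ?_
  cases n with
  | zero => simp [kummerMajorant, kummerCoeff]
  | succ n => simp [kummerMajorant]

theorem kummerQuot_zero_nonneg {s : ℝ} (hs : 0 ≤ s) : 0 ≤ kummerQuot (0 : ℝ) s :=
  tsum_nonneg fun n => mul_nonneg (kummerCoeff_zero_nonneg n) (by positivity)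

theorem two_mul_le_kummerQuot {a s : ℝ} (ha : |a| ≤ 1) (ha1 : -1 < a) (hs : 0 ≤ s) :
    2 * s ≤ kummerQuot a s := by
  have := (summable_kummerQuot (𝕜 := ℝ) (a := a) (by simpa using ha) s).le_tsum 1
    fun n _ => mul_nonneg (kummerCoeff_nonneg ha1 n) (by positivity)
  simpa [kummerCoeff, kummerQuot] using this

theorem kummerQuotDeriv_zero_le {s : ℝ} (hs : 0 ≤ s) :
    kummerQuotDeriv (0 : ℝ) s ≤ 2 + kummerQuot (0 : ℝ) s := by
  refine hasSum_le (fun n => ?_)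
    (summable_kummerQuotDeriv (norm_zero_le_one (𝕜 := ℝ)) s).hasSum (hasSum_kummerMajorant s)
  exact mul_le_mul_of_nonneg_right (succ_mul_kummerCoeff_zero_le n) (by positivity)

theorem kummerQuotDeriv2_zero_le {s : ℝ} (hs : 0 ≤ s) :
    kummerQuotDeriv2 (0 : ℝ) s ≤ 2 + kummerQuot (0 : ℝ) s := by
  refine hasSum_le (fun n => ?_)
    (summable_kummerQuotDeriv2 (norm_zero_le_one (𝕜 := ℝ)) s).hasSum (hasSum_kummerMajorant s)
  refine mul_le_mul_of_nonneg_right ?_ (by positivity)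
  refine le_trans ?_ (succ_mul_kummerMajorant_le n)
  have := succ_mul_kummerCoeff_zero_le (n + 1)
  push_cast at this
  refine mul_le_mul_of_nonneg_left (le_trans (le_of_eq ?_) this) (by positivity)
  ring

/-! ### Comparison of complex values with `Q(0, ·)` on the real axis -/

section Norms

variable {𝕜 : Type*} [RCLike 𝕜]

theorem norm_kummerQuot_le {a : 𝕜} (ha : ‖a‖ ≤ 1) (z : 𝕜) :
    ‖kummerQuot a z‖ ≤ ‖z‖ * (2 + kummerQuot (0 : ℝ) ‖z‖) := by
  have h := hasSum_mul_kummerQuotDeriv (norm_zero_le_one (𝕜 := ℝ)) ‖z‖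
  refine (tsum_of_norm_bounded h fun n => ?_).trans
    (mul_le_mul_of_nonneg_left (kummerQuotDeriv_zero_le (norm_nonneg z)) (norm_nonneg z))
  rw [norm_mul, norm_pow]
  exact mul_le_mul_of_nonneg_right (norm_kummerCoeff_le ha n) (by positivity)

/-- Lipschitz dependence on the parameter, needed for the contraction. The weight `n² = n + n (n -
1)` of the coefficient bound turns into `s Q' + s² Q''` at `a = 0`. -/
theorem norm_kummerQuot_sub_le {a b : 𝕜} (ha : ‖a‖ ≤ 1) (hb : ‖b‖ ≤ 1) (z : 𝕜) :
    ‖kummerQuot a z - kummerQuot b z‖ ≤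
      ‖a - b‖ * (‖z‖ * (‖z‖ + 1) * (2 + kummerQuot (0 : ℝ) ‖z‖)) := by
  set s := ‖z‖ with hs
  have hs0 : 0 ≤ s := norm_nonneg z
  have h1 := hasSum_mul_kummerQuotDeriv (norm_zero_le_one (𝕜 := ℝ)) s
  have h2 := hasSum_mul_kummerQuotDeriv2 (norm_zero_le_one (𝕜 := ℝ)) s
  have h2' : HasSum (fun n : ℕ => (n : ℝ) * (n - 1) * kummerCoeff (0 : ℝ) n * s ^ n)
      (s * (s * kummerQuotDeriv2 (0 : ℝ) s)) := by
    have := HasSum.zero_add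
      (f := fun n : ℕ => (n : ℝ) * (n - 1) * kummerCoeff (0 : ℝ) n * s ^ n)
      (m := s * (s * kummerQuotDeriv2 (0 : ℝ) s)) (by
        refine (h2.mul_left s).congr_fun ?_
        intro n; push_cast; ring)
    simpa using this
  have h3 := (h1.add h2').mul_left ‖a - b‖
  have e : kummerQuot a z - kummerQuot b z =
      ∑' n, (kummerCoeff a n - kummerCoeff b n) * z ^ n := by
    unfold kummerQuot
    rw [← (summable_kummerQuot ha z).tsum_sub (summable_kummerQuot hb z)]
    exact tsum_congr fun n => by ring
  rw [e]
  refine (tsum_of_norm_bounded h3 fun n => ?_).trans ?_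
  · rw [norm_mul, norm_pow, ← hs]
    calc _ ≤ ‖a - b‖ * (n ^ 2 * kummerCoeff (0 : ℝ) n) * s ^ n :=
          mul_le_mul_of_nonneg_right (norm_kummerCoeff_sub_le ha hb n) (by positivity)
      _ = _ := by ring
  · refine mul_le_mul_of_nonneg_left ?_ (norm_nonneg _)
    have e1 := kummerQuotDeriv_zero_le hs0
    have e2 := kummerQuotDeriv2_zero_le hs0
    calc _ ≤ s * (2 + kummerQuot (0 : ℝ) s) + s * (s * (2 + kummerQuot (0 : ℝ) s)) := by gcongr
      _ = _ := by ring

theorem norm_pow_sub_pow_le {z w : 𝕜} {r h : ℝ} (hw : ‖w‖ ≤ r) (hzw : ‖z - w‖ ≤ h) (n : ℕ) :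
    ‖z ^ n - w ^ n‖ ≤ (r + h) ^ n - r ^ n := by
  have hr : 0 ≤ r := (norm_nonneg w).trans hw
  have hh : 0 ≤ h := (norm_nonneg _).trans hzw
  have hz : ‖z‖ ≤ r + h := by
    have : ‖z‖ ≤ ‖w‖ + ‖z - w‖ := by
      simpa using norm_add_le w (z - w)
    linarith
  induction n with
  | zero => simp
  | succ n ih =>
    have e : z ^ (n + 1) - w ^ (n + 1) = z * (z ^ n - w ^ n) + (z - w) * w ^ n := by ring
    rw [e]
    calc _ ≤ ‖z‖ * ‖z ^ n - w ^ n‖ + ‖z - w‖ * ‖w‖ ^ n := by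
          refine (norm_add_le _ _).trans ?_
          rw [norm_mul, norm_mul, norm_pow]
      _ ≤ (r + h) * ((r + h) ^ n - r ^ n) + h * r ^ n := by gcongr
      _ = _ := by ring

/-- With nonnegative coefficients, the increment over a displacement of length `h` is largest along
the positive real axis. -/
theorem norm_kummerQuot_zero_sub_le {z w : 𝕜} {r h : ℝ} (hw : ‖w‖ ≤ r) (hzw : ‖z - w‖ ≤ h) :
    ‖kummerQuot 0 z - kummerQuot 0 w‖ ≤
      kummerQuot (0 : ℝ) (r + h) - kummerQuot (0 : ℝ) r := by
  have h0 : ∀ z : 𝕜, _ := fun z => summable_kummerQuot (norm_zero_le_one (𝕜 := 𝕜)) z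
  have h1 : ∀ z : ℝ, _ := fun z => summable_kummerQuot (norm_zero_le_one (𝕜 := ℝ)) z
  have e : kummerQuot 0 z - kummerQuot 0 w =
      ∑' n, kummerCoeff (0 : 𝕜) n * (z ^ n - w ^ n) := by
    unfold kummerQuot
    rw [← (h0 z).tsum_sub (h0 w)]
    exact tsum_congr fun n => by ring
  have h2 := (h1 (r + h)).hasSum.sub (h1 r).hasSum
  rw [e]
  refine tsum_of_norm_bounded h2 fun n => ?_
  have e3 : ‖kummerCoeff (0 : 𝕜) n‖ = kummerCoeff (0 : ℝ) n := by
    have : kummerCoeff (0 : 𝕜) n = ((kummerCoeff (0 : ℝ) n : ℝ) : 𝕜) := by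
      induction n with
      | zero => simp [kummerCoeff]
      | succ n ih =>
        cases n with
        | zero => exact (map_ofNat (algebraMap ℝ 𝕜) 2).symm
        | succ n =>
          rw [kummerCoeff_succ_succ, kummerCoeff_succ_succ, ih]
          push_cast; ring
    rw [this, RCLike.norm_ofReal, abs_of_nonneg (kummerCoeff_zero_nonneg n)]
  rw [norm_mul, e3, ← mul_sub]
  exact mul_le_mul_of_nonneg_left (norm_pow_sub_pow_le hw hzw n) (kummerCoeff_zero_nonneg n)

end Norms

theorem kummerQuot_zero_arg {𝕜 : Type*} [RCLike 𝕜] (a : 𝕜) : kummerQuot a 0 = 0 := by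
  unfold kummerQuot
  refine (tsum_congr fun n => ?_).trans tsum_zero
  cases n with
  | zero => simp [kummerCoeff]
  | succ n => simp

/-! ### Exponential growth of `Q(0, s)` -/

theorem antitoneOn_exp_neg_mul_kummerQuot :
    AntitoneOn (fun s : ℝ => Real.exp (-s) * (2 + kummerQuot (0 : ℝ) s)) (Set.Ici 0) := by
  have hd : ∀ s : ℝ, HasDerivAt (fun s : ℝ => Real.exp (-s) * (2 + kummerQuot (0 : ℝ) s))
      (Real.exp (-s) * (kummerQuotDeriv (0 : ℝ) s - (2 + kummerQuot (0 : ℝ) s))) s := by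
    intro s
    have h1 : HasDerivAt (fun s : ℝ => Real.exp (-s)) (-Real.exp (-s)) s := by
      simpa using (hasDerivAt_neg s).exp
    have h2 := (hasDerivAt_kummerQuot (norm_zero_le_one (𝕜 := ℝ)) s).const_add 2
    exact (h1.mul h2).congr_deriv (by ring)
  refine antitoneOn_of_deriv_nonpos (convex_Ici 0)
    (fun s _ => (hd s).continuousAt.continuousWithinAt)
    (fun s _ => (hd s).differentiableAt.differentiableWithinAt) fun s hs => ?_
  rw [interior_Ici] at hs
  rw [(hd s).deriv]
  have := kummerQuotDeriv_zero_le (le_of_lt hs)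
  exact mul_nonpos_of_nonneg_of_nonpos (Real.exp_pos _).le (by linarith)

theorem two_add_kummerQuot_add_le {s d : ℝ} (hs : 0 ≤ s) (hd : 0 ≤ d) :
    2 + kummerQuot (0 : ℝ) (s + d) ≤ Real.exp d * (2 + kummerQuot (0 : ℝ) s) := by
  have h := antitoneOn_exp_neg_mul_kummerQuot (a := s) (b := s + d) hs
    (by simp only [Set.mem_Ici]; linarith) (by linarith)
  have h2 := mul_le_mul_of_nonneg_left h (Real.exp_pos (s + d)).le
  simp only [← mul_assoc, ← Real.exp_add] at h2
  simpa using h2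

theorem two_add_kummerQuot_le {s : ℝ} (hs : 0 ≤ s) :
    2 + kummerQuot (0 : ℝ) s ≤ 2 * Real.exp s := by
  have := two_add_kummerQuot_add_le le_rfl hs
  rw [zero_add, kummerQuot_zero_arg] at this
  linarith

/-- At `a = 0` Kummer's equation is first order in `Q'`, namely `s Q'' + (1/2 - s) Q' = 1`, and `√s
e^{-s}` is its integrating factor: the derivative is `e^{-s} / √s`. -/
theorem monotoneOn_sqrt_mul_kummerQuotDeriv :
    MonotoneOn (fun s : ℝ => Real.sqrt s * Real.exp (-s) * kummerQuotDeriv (0 : ℝ) s)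
      (Set.Ioi 0) := by
  have hd : ∀ s : ℝ, 0 < s →
      HasDerivAt (fun s : ℝ => Real.sqrt s * Real.exp (-s) * kummerQuotDeriv (0 : ℝ) s)
      (Real.exp (-s) / Real.sqrt s) s := by
    intro s hs
    have h1 : HasDerivAt (fun s : ℝ => Real.exp (-s)) (-Real.exp (-s)) s := by
      simpa using (hasDerivAt_neg s).exp
    have h2 := hasDerivAt_kummerQuotDeriv (norm_zero_le_one (𝕜 := ℝ)) s
    have h3 := Real.hasDerivAt_sqrt hs.ne'
    refine ((h3.mul h1).mul h2).congr_deriv ?_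
    have ode := kummerQuot_ode (norm_zero_le_one (𝕜 := ℝ)) s
    rw [zero_mul, add_zero] at ode
    have hq : Real.sqrt s ≠ 0 := (Real.sqrt_pos.2 hs).ne'
    have hsq : Real.sqrt s * Real.sqrt s = s := Real.mul_self_sqrt hs.le
    simp only [Pi.mul_apply]
    set q := Real.sqrt s
    rw [← mul_right_inj' hq, mul_div_cancel₀ _ hq]
    field_simp
    linear_combination 2 * ode + (2 * kummerQuotDeriv2 (0 : ℝ) s - 2 * kummerQuotDeriv (0 : ℝ) s) * hsq
  refine monotoneOn_of_deriv_nonneg (convex_Ioi 0)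
    (fun s hs => (hd s hs).continuousAt.continuousWithinAt)
    (fun s hs => (hd s (by simpa using hs)).differentiableAt.differentiableWithinAt) fun s hs => ?_
  rw [interior_Ioi] at hs
  rw [(hd s hs).deriv]
  positivity

/-- Monotonicity from `s = 1`, where `Q' ≥ 2`, bounds `Q'` below; then `Q' ≤ 2 + Q ≤ 2 Q`, because
`Q ≥ 2 s ≥ 2`. The constant `3` is a bound for `e`. -/
theorem exp_le_sqrt_mul_kummerQuot {s : ℝ} (hs : 1 ≤ s) :
    Real.exp s ≤ 3 * Real.sqrt s * kummerQuot (0 : ℝ) s := by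
  have h := monotoneOn_sqrt_mul_kummerQuotDeriv (a := 1) (b := s) (by simp)
    (by simp only [Set.mem_Ioi]; linarith) hs
  simp only [Real.sqrt_one, one_mul] at h
  have h1 : (2 : ℝ) ≤ kummerQuotDeriv (0 : ℝ) 1 := by
    have := (summable_kummerQuotDeriv (norm_zero_le_one (𝕜 := ℝ)) 1).le_tsum 0
      fun n _ => mul_nonneg (mul_nonneg (by positivity) (kummerCoeff_zero_nonneg _)) (by positivity)
    simpa [kummerCoeff, kummerQuotDeriv] using this
  have h2 := kummerQuotDeriv_zero_le (s := s) (by linarith)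
  have h3 := two_mul_le_kummerQuot (a := 0) (s := s) (by simp) (by norm_num) (by linarith)
  have h4 : Real.exp (-1) * 2 ≤ Real.sqrt s * Real.exp (-s) * (2 * kummerQuot (0 : ℝ) s) := by
    calc _ ≤ _ := mul_le_mul_of_nonneg_left h1 (Real.exp_pos _).le
      _ ≤ _ := h
      _ ≤ _ := by
        refine mul_le_mul_of_nonneg_left ?_ (by positivity)
        linarith
  have h5 : Real.exp (-1) ≤ Real.sqrt s * Real.exp (-s) * kummerQuot (0 : ℝ) s := by linarith
  have h6 := mul_le_mul_of_nonneg_left h5 (Real.exp_pos (s + 1)).le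
  have e1 : Real.exp (s + 1) * Real.exp (-1) = Real.exp s := by
    rw [← Real.exp_add]; ring_nf
  have e2 : Real.exp (s + 1) * (Real.sqrt s * Real.exp (-s) * kummerQuot (0 : ℝ) s) =
      Real.exp 1 * (Real.sqrt s * kummerQuot (0 : ℝ) s) := by
    have : Real.exp (s + 1) * Real.exp (-s) = Real.exp 1 := by
      rw [← Real.exp_add]; ring_nf
    linear_combination Real.sqrt s * kummerQuot (0 : ℝ) s * this
  rw [e1, e2] at h6
  have h7 : Real.exp 1 ≤ 3 := Real.exp_one_lt_d9.le.trans (by norm_num)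
  have h8 : 0 ≤ Real.sqrt s * kummerQuot (0 : ℝ) s :=
    mul_nonneg (Real.sqrt_nonneg _) (kummerQuot_zero_nonneg (by linarith))
  nlinarith

/-! ### Jacobi's argument for the least eigenvalue -/

theorem eq_zero_of_monotoneOn_of_abs_le {Φ : ℝ → ℝ} {K : ℝ}
    (hm : MonotoneOn Φ (Set.Ioo (-1) 1)) (hK : ∀ x ∈ Set.Ioo (-1 : ℝ) 1, |Φ x| ≤ K * (1 - x ^ 2)) :
    ∀ x ∈ Set.Ioo (-1 : ℝ) 1, Φ x = 0 := by
  intro x hx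
  have hc : Continuous fun t : ℝ => K * (1 - t ^ 2) := by fun_prop
  apply le_antisymm
  · have ht : Filter.Tendsto (fun t : ℝ => K * (1 - t ^ 2)) (nhdsWithin 1 (Set.Iio 1)) (nhds 0) := by
      have := (hc.tendsto 1).mono_left (nhdsWithin_le_nhds (s := Set.Iio 1))
      simpa using this
    refine ge_of_tendsto ht ?_
    filter_upwards [Ioo_mem_nhdsLT hx.2] with t ht
    have ht' : t ∈ Set.Ioo (-1 : ℝ) 1 := ⟨hx.1.trans ht.1, ht.2⟩
    exact (hm hx ht' ht.1.le).trans ((le_abs_self _).trans (hK t ht'))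
  · have ht : Filter.Tendsto (fun t : ℝ => -(K * (1 - t ^ 2))) (nhdsWithin (-1) (Set.Ioi (-1)))
        (nhds 0) := by
      have hc' : Continuous fun t : ℝ => -(K * (1 - t ^ 2)) := hc.neg
      have := (hc'.tendsto (-1)).mono_left (nhdsWithin_le_nhds (s := Set.Ioi (-1)))
      simpa using this
    refine le_of_tendsto ht ?_
    filter_upwards [Ioo_mem_nhdsGT hx.1] with t ht
    have ht' : t ∈ Set.Ioo (-1 : ℝ) 1 := ⟨ht.1, ht.2.trans hx.2⟩
    have := hm ht' hx ht.2.le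
    have h2 := hK t ht'
    linarith [neg_abs_le (Φ t)]

namespace IsDirichletEigenfunction

variable {w E : ℝ} {y : ℝ → ℝ}

theorem hasDerivAt (hy : IsDirichletEigenfunction w E y) {x : ℝ} (hx : x ∈ Set.Ioo (-1 : ℝ) 1) :
    HasDerivAt y (deriv y x) x :=
  ((hy.contDiffOn.differentiableOn (by norm_num)).differentiableAt
    (isOpen_Ioo.mem_nhds hx)).hasDerivAt

theorem hasDerivAt_deriv (hy : IsDirichletEigenfunction w E y) {x : ℝ}
    (hx : x ∈ Set.Ioo (-1 : ℝ) 1) :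
    HasDerivAt (deriv y) ((w ^ 2 * x ^ 2 - E) * y x) x := by
  have h1 : ContDiffOn ℝ 1 (deriv y) (Set.Ioo (-1) 1) :=
    hy.contDiffOn.deriv_of_isOpen isOpen_Ioo (by norm_num)
  have h2 := ((h1.differentiableOn (by norm_num)).differentiableAt
    (isOpen_Ioo.mem_nhds hx)).hasDerivAt
  exact h2.congr_deriv (by linarith [hy.eigen x hx])

/-- The equation bounds `y''`, hence `y'`, even though regularity is assumed only in the open
interval; the mean value theorem from each end point then gives linear vanishing. This controls `y²
/ u` near `±1`. -/
theorem exists_bound (hy : IsDirichletEigenfunction w E y) :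
    ∃ D : ℝ, 0 ≤ D ∧ ∀ x ∈ Set.Ioo (-1 : ℝ) 1, |deriv y x| ≤ D ∧ |y x| ≤ D * (1 - x ^ 2) := by
  obtain ⟨Y, hY⟩ := isCompact_Icc.exists_bound_of_continuousOn hy.continuousOn
  have hY0 : 0 ≤ Y := (norm_nonneg _).trans (hY 0 (by norm_num))
  have h0 : (0 : ℝ) ∈ Set.Ioo (-1 : ℝ) 1 := by norm_num
  set B := (w ^ 2 + |E|) * Y with hB
  set D := |deriv y 0| + B with hD
  have hB0 : 0 ≤ B := by positivity
  have hy2 : ∀ x ∈ Set.Ioo (-1 : ℝ) 1, ‖(w ^ 2 * x ^ 2 - E) * y x‖ ≤ B := by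
    intro x hx
    rw [norm_mul]
    refine mul_le_mul ?_ (hY x (Set.Ioo_subset_Icc_self hx)) (norm_nonneg _) (by positivity)
    refine (norm_sub_le _ _).trans ?_
    rw [Real.norm_eq_abs, Real.norm_eq_abs, abs_of_nonneg (by positivity)]
    have : x ^ 2 ≤ 1 := by rw [sq_le_one_iff_abs_le_one, abs_le]; exact ⟨hx.1.le, hx.2.le⟩
    have := mul_le_mul_of_nonneg_left this (sq_nonneg w)
    linarith
  have hd : ∀ x ∈ Set.Ioo (-1 : ℝ) 1, |deriv y x| ≤ D := by
    intro x hx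
    have := (convex_Ioo (-1 : ℝ) 1).norm_image_sub_le_of_norm_hasDerivWithin_le
      (fun x hx => (hy.hasDerivAt_deriv hx).hasDerivWithinAt) hy2 h0 hx
    rw [Real.norm_eq_abs, Real.norm_eq_abs, sub_zero] at this
    have hx1 : |x| ≤ 1 := abs_le.2 ⟨hx.1.le, hx.2.le⟩
    have h3 := abs_sub_abs_le_abs_sub (deriv y x) (deriv y 0)
    nlinarith
  refine ⟨D, by positivity, fun x hx => ⟨hd x hx, ?_⟩⟩
  have hD0 : 0 ≤ D := by positivity
  have hr : |y x| ≤ D * (1 - x) := by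
    obtain ⟨c, hc, e⟩ := exists_hasDerivAt_eq_slope y (deriv y) hx.2
      (hy.continuousOn.mono (Set.Icc_subset_Icc_left hx.1.le))
      fun t ht => hy.hasDerivAt ⟨hx.1.trans ht.1, ht.2⟩
    have hpos : 0 < 1 - x := by linarith [hx.2]
    have h1 := hd c ⟨hx.1.trans hc.1, hc.2⟩
    rw [e, hy.right, zero_sub, abs_div, abs_neg, abs_of_pos hpos, div_le_iff₀ hpos] at h1
    exact h1
  have hl : |y x| ≤ D * (1 + x) := by
    obtain ⟨c, hc, e⟩ := exists_hasDerivAt_eq_slope y (deriv y) hx.1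
      (hy.continuousOn.mono (Set.Icc_subset_Icc_right hx.2.le))
      fun t ht => hy.hasDerivAt ⟨ht.1, ht.2.trans hx.2⟩
    have hpos : 0 < x - -1 := by linarith [hx.1]
    have h1 := hd c ⟨hc.1, hc.2.trans hx.2⟩
    rw [e, hy.left, sub_zero, abs_div, abs_of_pos hpos, div_le_iff₀ hpos] at h1
    linarith
  rcases le_total 0 x with h | h
  · refine hr.trans (mul_le_mul_of_nonneg_left ?_ hD0)
    nlinarith [hx.2]
  · refine hl.trans (mul_le_mul_of_nonneg_left ?_ hD0)
    nlinarith [hx.1]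

/-- Jacobi's argument: a positive eigenfunction vanishing linearly at the end points belongs to
the least eigenvalue, and that eigenvalue is simple. -/
theorem eq_of_le_of_positive (hy : IsDirichletEigenfunction w E y) {L c : ℝ} {u u₁ : ℝ → ℝ}
    (hc : 0 < c) (hu : ∀ x, HasDerivAt u (u₁ x) x)
    (hu₁ : ∀ x, HasDerivAt u₁ ((w ^ 2 * x ^ 2 - L) * u x) x)
    (hpos : ∀ x ∈ Set.Icc (-1 : ℝ) 1, c * (1 - x ^ 2) ≤ u x) (hl : u (-1) = 0) (hr : u 1 = 0)
    (hE : E ≤ L) :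
    E = L ∧ ∃ k : ℝ, ∀ x ∈ Set.Icc (-1 : ℝ) 1, y x = k * u x := by
  obtain ⟨D, hD0, hD⟩ := hy.exists_bound
  have hu₁c : Continuous u₁ := continuous_iff_continuousAt.2 fun x => (hu₁ x).continuousAt
  obtain ⟨U, hU⟩ := (isCompact_Icc (a := (-1 : ℝ)) (b := 1)).exists_bound_of_continuousOn
    hu₁c.continuousOn
  have hsq : ∀ x ∈ Set.Ioo (-1 : ℝ) 1, 0 < 1 - x ^ 2 := by
    intro x hx; nlinarith [hx.1, hx.2]
  have hup : ∀ x ∈ Set.Ioo (-1 : ℝ) 1, 0 < u x := fun x hx =>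
    (mul_pos hc (hsq x hx)).trans_le (hpos x (Set.Ioo_subset_Icc_self hx))
  -- Picone's identity: the derivative of `Φ` is a square plus `(L - E) y²`. So `Φ` is monotone, and
  -- since it vanishes at both ends it is zero, which kills both terms.
  set Φ : ℝ → ℝ := fun x => y x * deriv y x - u₁ x * (y x ^ 2 / u x) with hΦ
  have hΦd : ∀ x ∈ Set.Ioo (-1 : ℝ) 1,
      HasDerivAt Φ ((deriv y x - u₁ x * y x / u x) ^ 2 + (L - E) * y x ^ 2) x := by
    intro x hx
    have hne := (hup x hx).ne'
    have h1 := hy.hasDerivAt hx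
    have h2 := hy.hasDerivAt_deriv hx
    refine ((h1.mul h2).sub ((hu₁ x).mul ((h1.pow 2).div (hu x) hne))).congr_deriv ?_
    simp only [Pi.div_apply, Pi.pow_apply]
    field_simp
    push_cast
    ring
  have hΦm : MonotoneOn Φ (Set.Ioo (-1) 1) := by
    refine monotoneOn_of_deriv_nonneg (convex_Ioo _ _)
      (fun x hx => (hΦd x hx).continuousAt.continuousWithinAt)
      (fun x hx => (hΦd x (by simpa using hx)).differentiableAt.differentiableWithinAt) ?_
    intro x hx
    rw [interior_Ioo] at hx
    rw [(hΦd x hx).deriv]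
    have : 0 ≤ L - E := by linarith
    positivity
  have hU0 : 0 ≤ U := (norm_nonneg _).trans (hU 0 (by norm_num))
  have hΦb : ∀ x ∈ Set.Ioo (-1 : ℝ) 1, |Φ x| ≤ (D * D + U * (D ^ 2 / c)) * (1 - x ^ 2) := by
    intro x hx
    have hs := hsq x hx
    obtain ⟨hd1, hd2⟩ := hD x hx
    have e1 : |y x * deriv y x| ≤ D * (1 - x ^ 2) * D := by
      rw [abs_mul]; gcongr
    have e2 : |y x ^ 2 / u x| ≤ D ^ 2 / c * (1 - x ^ 2) := by
      rw [abs_div, abs_pow, abs_of_pos (hup x hx)]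
      calc _ ≤ (D * (1 - x ^ 2)) ^ 2 / (c * (1 - x ^ 2)) := by
            have := hpos x (Set.Ioo_subset_Icc_self hx)
            gcongr
        _ = _ := by field_simp
    have e3 : |u₁ x * (y x ^ 2 / u x)| ≤ U * (D ^ 2 / c * (1 - x ^ 2)) := by
      rw [abs_mul]
      exact mul_le_mul (hU x (Set.Ioo_subset_Icc_self hx)) e2 (abs_nonneg _) hU0
    calc |Φ x| ≤ |y x * deriv y x| + |u₁ x * (y x ^ 2 / u x)| := abs_sub _ _
      _ ≤ _ := by linarith
  have hΦ0 := eq_zero_of_monotoneOn_of_abs_le hΦm hΦb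
  have hzero : ∀ x ∈ Set.Ioo (-1 : ℝ) 1,
      (deriv y x - u₁ x * y x / u x) ^ 2 + (L - E) * y x ^ 2 = 0 := by
    intro x hx
    refine (hΦd x hx).unique ?_
    refine (hasDerivAt_const x (0 : ℝ)).congr_of_eventuallyEq ?_
    filter_upwards [isOpen_Ioo.mem_nhds hx] with t ht using hΦ0 t ht
  have hLE : E = L := by
    obtain ⟨x, hx, hne⟩ := hy.nonzero
    have h1 := hzero x hx
    have h2 : 0 ≤ (L - E) * y x ^ 2 := mul_nonneg (by linarith) (sq_nonneg _)
    have h3 : (L - E) * y x ^ 2 = 0 := by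
      linarith [sq_nonneg (deriv y x - u₁ x * y x / u x)]
    rcases mul_eq_zero.1 h3 with h | h
    · linarith
    · exact absurd (pow_eq_zero_iff (two_ne_zero) |>.1 h) hne
  refine ⟨hLE, y 0 / u 0, ?_⟩
  have h0 : (0 : ℝ) ∈ Set.Ioo (-1 : ℝ) 1 := by norm_num
  -- Vanishing of the square says that `y` and `u` have the same logarithmic derivative, so their
  -- quotient is constant.
  have hq : ∀ x ∈ Set.Ioo (-1 : ℝ) 1, HasDerivAt (fun t => y t / u t) 0 x := by
    intro x hx
    have hne := (hup x hx).ne'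
    refine ((hy.hasDerivAt hx).div (hu x) hne).congr_deriv ?_
    have h1 := hzero x hx
    rw [hLE, sub_self, zero_mul, add_zero, pow_eq_zero_iff two_ne_zero] at h1
    have h2 : deriv y x = u₁ x * y x / u x := by linarith
    rw [h2]
    field_simp
    ring
  have hcst : ∀ x ∈ Set.Ioo (-1 : ℝ) 1, y x / u x = y 0 / u 0 := by
    intro x hx
    have := (convex_Ioo (-1 : ℝ) 1).norm_image_sub_le_of_norm_hasDerivWithin_le (C := 0)
      (fun x hx => (hq x hx).hasDerivWithinAt) (fun x _ => by simp) h0 hx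
    rw [zero_mul, norm_le_zero_iff, sub_eq_zero] at this
    exact this
  intro x hx
  rcases eq_or_lt_of_le hx.1 with h | h
  · rw [← h, hy.left, hl, mul_zero]
  rcases eq_or_lt_of_le hx.2 with h' | h'
  · rw [h', hy.right, hr, mul_zero]
  rw [← hcst x ⟨h, h'⟩, div_mul_cancel₀ _ (hup x ⟨h, h'⟩).ne']

end IsDirichletEigenfunction

/-! ### The even solution and the ground state -/

/-- The even solution `u` of `-u'' + w² x² u = w (1 - 4 a) u` with `u 0 = 1`. -/
noncomputable def evenSolution (w a x : ℝ) : ℝ :=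
  Real.exp (-(w * x ^ 2 / 2)) * (1 + a * kummerQuot a (w * x ^ 2))

/-- The derivative of `evenSolution w a`. -/
noncomputable def evenSolutionDeriv (w a x : ℝ) : ℝ :=
  Real.exp (-(w * x ^ 2 / 2)) * (a * (kummerQuotDeriv a (w * x ^ 2) * (w * (2 * x))) -
    w * x * (1 + a * kummerQuot a (w * x ^ 2)))

theorem hasDerivAt_exp_neg_mul_sq (w x : ℝ) :
    HasDerivAt (fun x : ℝ => Real.exp (-(w * x ^ 2 / 2)))
      (Real.exp (-(w * x ^ 2 / 2)) * (-(w * x))) x := by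
  have h : HasDerivAt (fun x : ℝ => -(w * x ^ 2 / 2)) (-(w * x)) x :=
    ((((hasDerivAt_pow 2 x).const_mul w).div_const 2).neg).congr_deriv (by push_cast; ring)
  exact h.exp

theorem hasDerivAt_mul_sq (w x : ℝ) : HasDerivAt (fun x : ℝ => w * x ^ 2) (w * (2 * x)) x :=
  ((hasDerivAt_pow 2 x).const_mul w).congr_deriv (by push_cast; ring)

section EvenSolution

variable {w a : ℝ}

theorem hasDerivAt_evenSolution (ha : ‖a‖ ≤ 1) (x : ℝ) :
    HasDerivAt (evenSolution w a) (evenSolutionDeriv w a x) x := by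
  have h1 := hasDerivAt_exp_neg_mul_sq w x
  have h2 := ((hasDerivAt_kummerQuot ha (w * x ^ 2)).comp x
    (hasDerivAt_mul_sq w x)).const_mul a |>.const_add 1
  refine (h1.mul h2).congr_deriv ?_
  simp only [Function.comp_apply, evenSolutionDeriv]
  ring

theorem hasDerivAt_evenSolutionDeriv (ha : ‖a‖ ≤ 1) (x : ℝ) :
    HasDerivAt (evenSolutionDeriv w a)
      ((w ^ 2 * x ^ 2 - w * (1 - 4 * a)) * evenSolution w a x) x := by
  have h1 := hasDerivAt_exp_neg_mul_sq w x
  have h2 := ((hasDerivAt_kummerQuot ha (w * x ^ 2)).comp x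
    (hasDerivAt_mul_sq w x)).const_mul a |>.const_add 1
  have h3 := (hasDerivAt_kummerQuotDeriv ha (w * x ^ 2)).comp x (hasDerivAt_mul_sq w x)
  have h4 : HasDerivAt (fun x : ℝ => w * (2 * x)) (w * 2) x :=
    (((hasDerivAt_id x).const_mul 2).const_mul w).congr_deriv (by ring)
  have h5 : HasDerivAt (fun x : ℝ => w * x) w x :=
    ((hasDerivAt_id x).const_mul w).congr_deriv (by ring)
  have h := h1.mul (((h3.mul h4).const_mul a).sub (h5.mul h2))
  refine h.congr_deriv ?_
  simp only [Function.comp_apply, evenSolution, Pi.mul_apply, Pi.sub_apply]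
  linear_combination (4 * w * a * Real.exp (-(w * x ^ 2 / 2))) * kummerQuot_ode ha (w * x ^ 2)

theorem contDiff_evenSolution (ha : ‖a‖ ≤ 1) : ContDiff ℝ 2 (evenSolution w a) := by
  have e1 : deriv (evenSolution w a) = evenSolutionDeriv w a :=
    funext fun x => (hasDerivAt_evenSolution ha x).deriv
  have e2 : deriv (evenSolutionDeriv w a) =
      fun x => (w ^ 2 * x ^ 2 - w * (1 - 4 * a)) * evenSolution w a x :=
    funext fun x => (hasDerivAt_evenSolutionDeriv ha x).deriv
  have hc : Continuous (evenSolution w a) :=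
    continuous_iff_continuousAt.2 fun x => (hasDerivAt_evenSolution ha x).continuousAt
  have h1 : ContDiff ℝ 1 (evenSolutionDeriv w a) := by
    rw [contDiff_one_iff_deriv, e2]
    exact ⟨fun x => (hasDerivAt_evenSolutionDeriv ha x).differentiableAt, by fun_prop⟩
  rw [show (2 : WithTop ℕ∞) = 1 + 1 by norm_num, contDiff_succ_iff_deriv, e1]
  exact ⟨fun x => (hasDerivAt_evenSolution ha x).differentiableAt, by simp, h1⟩

theorem continuous_evenSolution (ha : ‖a‖ ≤ 1) : Continuous (evenSolution w a) :=
  (contDiff_evenSolution ha).continuous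

/-- A point `(w, a)` of the zero set of `M(a, 1/2, w)` with `w > 0` and `-1 < a < 0`. -/
structure IsKummerZero (w a : ℝ) : Prop where
  pos : 0 < w
  neg_one_lt : -1 < a
  neg : a < 0
  zero : 1 + a * kummerQuot a w = 0

namespace IsKummerZero

theorem norm_le (h : IsKummerZero w a) : ‖a‖ ≤ 1 := by
  rw [Real.norm_eq_abs, abs_le]; exact ⟨h.neg_one_lt.le, by linarith [h.neg]⟩

/-- The series of `Q(a, ·)` has nonnegative coefficients and no constant term, so `Q(a, w x²) ≤ x²
Q(a, w)`; multiplying by `a < 0` and using `a Q(a, w) = -1` gives the lower bound. -/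
theorem factor_bounds (h : IsKummerZero w a) {x : ℝ} (hx : |x| ≤ 1) :
    1 - x ^ 2 ≤ 1 + a * kummerQuot a (w * x ^ 2) ∧ 1 + a * kummerQuot a (w * x ^ 2) ≤ 1 := by
  have hw := h.pos
  have hs := summable_kummerQuot h.norm_le
  have hnn := fun n => kummerCoeff_nonneg h.neg_one_lt n
  have hx2 : x ^ 2 ≤ 1 := by rwa [sq_le_one_iff_abs_le_one]
  have h0 : 0 ≤ kummerQuot a (w * x ^ 2) :=
    tsum_nonneg fun n => mul_nonneg (hnn n) (by positivity)
  have h1 : kummerQuot a (w * x ^ 2) ≤ x ^ 2 * kummerQuot a w := by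
    refine hasSum_le (fun n => ?_) (hs _).hasSum ((hs w).hasSum.mul_left (x ^ 2))
    cases n with
    | zero => simp [kummerCoeff]
    | succ n =>
      have : (x ^ 2) ^ (n + 1) ≤ x ^ 2 := by
        rw [pow_succ]
        exact mul_le_of_le_one_left (sq_nonneg x) (pow_le_one₀ (sq_nonneg x) hx2)
      calc kummerCoeff a (n + 1) * (w * x ^ 2) ^ (n + 1)
          = kummerCoeff a (n + 1) * w ^ (n + 1) * (x ^ 2) ^ (n + 1) := by rw [mul_pow]; ring
        _ ≤ kummerCoeff a (n + 1) * w ^ (n + 1) * x ^ 2 :=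
            mul_le_mul_of_nonneg_left this (mul_nonneg (hnn _) (by positivity))
        _ = _ := by ring
  constructor
  · nlinarith [h.zero, h.neg]
  · nlinarith [h.neg]

theorem le_evenSolution (h : IsKummerZero w a) {x : ℝ} (hx : x ∈ Set.Icc (-1 : ℝ) 1) :
    Real.exp (-(w / 2)) * (1 - x ^ 2) ≤ evenSolution w a x := by
  have hx1 : |x| ≤ 1 := abs_le.2 hx
  have hx2 : x ^ 2 ≤ 1 := by rwa [sq_le_one_iff_abs_le_one]
  have hw := h.pos
  refine mul_le_mul (Real.exp_le_exp.2 ?_) (h.factor_bounds hx1).1 (by linarith)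
    (Real.exp_pos _).le
  nlinarith

theorem evenSolution_pos (h : IsKummerZero w a) {x : ℝ} (hx : x ∈ Set.Ioo (-1 : ℝ) 1) :
    0 < evenSolution w a x := by
  refine lt_of_lt_of_le (mul_pos (Real.exp_pos _) ?_)
    (h.le_evenSolution (Set.Ioo_subset_Icc_self hx))
  nlinarith [hx.1, hx.2]

theorem evenSolution_left (h : IsKummerZero w a) : evenSolution w a (-1) = 0 := by
  simp [evenSolution, h.zero]

theorem evenSolution_right (h : IsKummerZero w a) : evenSolution w a 1 = 0 := by
  simp [evenSolution, h.zero]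

theorem isDirichletEigenfunction (h : IsKummerZero w a) {k : ℝ} (hk : k ≠ 0) :
    IsDirichletEigenfunction w (w * (1 - 4 * a)) fun x => k * evenSolution w a x where
  continuousOn := (continuous_const.mul (continuous_evenSolution h.norm_le)).continuousOn
  contDiffOn := (contDiff_const.mul (contDiff_evenSolution h.norm_le)).contDiffOn
  eigen := by
    intro x _
    have e1 : deriv (fun x => k * evenSolution w a x) = fun x => k * evenSolutionDeriv w a x :=
      funext fun x => ((hasDerivAt_evenSolution h.norm_le x).const_mul k).deriv
    rw [e1, ((hasDerivAt_evenSolutionDeriv h.norm_le x).const_mul k).deriv]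
    ring
  left := by simp [h.evenSolution_left]
  right := by simp [h.evenSolution_right]
  nonzero := ⟨0, by norm_num, mul_ne_zero hk (h.evenSolution_pos (by norm_num)).ne'⟩

theorem isLeast (h : IsKummerZero w a) :
    IsLeast (dirichletEigenvalues w) (w * (1 - 4 * a)) := by
  refine ⟨⟨_, h.isDirichletEigenfunction one_ne_zero⟩, ?_⟩
  rintro E ⟨y, hy⟩
  by_contra hlt
  push Not at hlt
  exact hlt.ne (hy.eq_of_le_of_positive (Real.exp_pos _) (hasDerivAt_evenSolution h.norm_le)
    (hasDerivAt_evenSolutionDeriv h.norm_le) (fun x hx => h.le_evenSolution hx)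
    h.evenSolution_left h.evenSolution_right hlt.le).1

theorem firstEigenvalue_eq (h : IsKummerZero w a) : firstEigenvalue w = w * (1 - 4 * a) :=
  h.isLeast.csInf_eq

theorem integral_pos (h : IsKummerZero w a) : 0 < ∫ x in (-1 : ℝ)..1, evenSolution w a x ^ 2 := by
  refine intervalIntegral.intervalIntegral_pos_of_pos_on
    (((continuous_evenSolution h.norm_le).pow 2).intervalIntegrable _ _)
    (fun x hx => pow_pos (h.evenSolution_pos hx) 2) (by norm_num)

theorem isFirstEigenfunction (h : IsKummerZero w a) :
    IsFirstEigenfunction w (firstEigenfunction w) := by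
  refine Classical.epsilon_spec
    (p := IsFirstEigenfunction w)
    ⟨fun x => (Real.sqrt (∫ x in (-1 : ℝ)..1, evenSolution w a x ^ 2))⁻¹ * evenSolution w a x,
      ?_, ?_, ?_⟩
  · rw [h.firstEigenvalue_eq]
    exact h.isDirichletEigenfunction (inv_ne_zero (Real.sqrt_pos.2 h.integral_pos).ne')
  · simp only [mul_pow, inv_pow, Real.sq_sqrt h.integral_pos.le]
    rw [intervalIntegral.integral_const_mul, inv_mul_cancel₀ h.integral_pos.ne']
  · exact mul_pos (inv_pos.2 (Real.sqrt_pos.2 h.integral_pos)) (h.evenSolution_pos (by norm_num))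

/-- Simplicity makes the chosen eigenfunction a multiple of the even solution; the sign at `0` and
the norm determine the multiple. -/
theorem firstEigenfunction_eq (h : IsKummerZero w a) {x : ℝ} (hx : |x| ≤ 1) :
    firstEigenfunction w x =
      (Real.sqrt (∫ x in (-1 : ℝ)..1, evenSolution w a x ^ 2))⁻¹ * evenSolution w a x := by
  have hf := h.isFirstEigenfunction
  obtain ⟨k, hk⟩ := (hf.eigenfunction.eq_of_le_of_positive (Real.exp_pos _)
    (hasDerivAt_evenSolution h.norm_le) (hasDerivAt_evenSolutionDeriv h.norm_le)
    (fun x hx => h.le_evenSolution hx) h.evenSolution_left h.evenSolution_right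
    h.firstEigenvalue_eq.le).2
  rw [hk x (abs_le.1 hx)]
  congr 1
  have hk0 : 0 < k := by
    have := hf.pos_zero
    rw [hk 0 (by norm_num)] at this
    exact (mul_pos_iff_of_pos_right (h.evenSolution_pos (by norm_num))).1 this
  have hn := hf.norm_one
  have e : ∫ x in (-1 : ℝ)..1, firstEigenfunction w x ^ 2 =
      ∫ x in (-1 : ℝ)..1, k ^ 2 * evenSolution w a x ^ 2 := by
    refine intervalIntegral.integral_congr fun x hx => ?_
    rw [Set.uIcc_of_le (by norm_num)] at hx
    simp only [hk x hx, mul_pow]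
  rw [e, intervalIntegral.integral_const_mul] at hn
  have hI := h.integral_pos
  set I := ∫ x in (-1 : ℝ)..1, evenSolution w a x ^ 2
  have h2 : (k * Real.sqrt I) ^ 2 = 1 := by rw [mul_pow, Real.sq_sqrt hI.le, hn]
  have h3 : k * Real.sqrt I = 1 :=
    (pow_eq_one_iff_of_nonneg (by positivity) two_ne_zero).1 h2
  exact eq_inv_of_mul_eq_one_left h3

end IsKummerZero

end EvenSolution

/-! ### Normalization and pointwise bounds -/

theorem integral_exp_neg_mul_sq_le {b : ℝ} (hb : 0 < b) :
    ∫ x in (-1 : ℝ)..1, Real.exp (-b * x ^ 2) ≤ Real.sqrt (Real.pi / b) := by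
  rw [← integral_gaussian b, intervalIntegral.integral_of_le (by norm_num)]
  exact MeasureTheory.setIntegral_le_integral (integrable_exp_neg_mul_sq hb)
    (Filter.Eventually.of_forall fun x => (Real.exp_pos _).le)

/-- Only the window `|x| ≤ w^{-1/2}` is used. There `e^{-w x²} ≥ 1 - w x²` and `(1 - x²)² ≥
(9/10)²`, and the resulting integral is `(81/100) (4/3) w^{-1/2}`, just above the claim. -/
theorem inv_sqrt_le_integral {w : ℝ} (hw : 10 ≤ w) {f : ℝ → ℝ} (hf : Continuous f)
    (h : ∀ x ∈ Set.Icc (-1 : ℝ) 1, Real.exp (-w * x ^ 2) * (1 - x ^ 2) ^ 2 ≤ f x) :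
    (Real.sqrt w)⁻¹ ≤ ∫ x in (-1 : ℝ)..1, f x := by
  have hw0 : 0 < w := by linarith
  set r := (Real.sqrt w)⁻¹ with hr
  have hr0 : 0 < r := inv_pos.2 (Real.sqrt_pos.2 hw0)
  have hr2 : w * r ^ 2 = 1 := by
    rw [hr, inv_pow, Real.sq_sqrt hw0.le, mul_inv_cancel₀ hw0.ne']
  have hr10 : r ^ 2 ≤ 1 / 10 := by nlinarith [sq_nonneg r]
  have hr1 : r ≤ 1 := by nlinarith
  have hnn : ∀ x ∈ Set.Icc (-1 : ℝ) 1, 0 ≤ f x := fun x hx =>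
    (mul_nonneg (Real.exp_pos _).le (sq_nonneg _)).trans (h x hx)
  have h1 : ∫ x in (-r)..r, f x ≤ ∫ x in (-1 : ℝ)..1, f x := by
    refine intervalIntegral.integral_mono_interval (by linarith) (by linarith) hr1 ?_
      (hf.intervalIntegrable _ _)
    refine (MeasureTheory.ae_restrict_iff' measurableSet_Ioc).2
      (Filter.Eventually.of_forall fun x hx => hnn x ⟨hx.1.le, hx.2⟩)
  have h2 : ∫ x in (-r)..r, (81 / 100 : ℝ) * (1 - w * x ^ 2) ≤ ∫ x in (-r)..r, f x := by
    refine intervalIntegral.integral_mono_on (by linarith)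
      (Continuous.intervalIntegrable (by fun_prop) _ _) (hf.intervalIntegrable _ _) ?_
    intro x hx
    have hx2 : x ^ 2 ≤ r ^ 2 := sq_le_sq' hx.1 hx.2
    refine le_trans ?_ (h x ⟨by linarith [hx.1], by linarith [hx.2]⟩)
    have e1 : 1 - w * x ^ 2 ≤ Real.exp (-w * x ^ 2) := by
      have := Real.add_one_le_exp (-w * x ^ 2); linarith
    have e2 : 0 ≤ 1 - w * x ^ 2 := by nlinarith
    have e3 : (81 / 100 : ℝ) ≤ (1 - x ^ 2) ^ 2 := by nlinarith
    calc _ = (1 - w * x ^ 2) * (81 / 100 : ℝ) := by ring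
      _ ≤ _ := mul_le_mul e1 e3 (by norm_num) (Real.exp_pos _).le
  have h3 : ∫ x in (-r)..r, (81 / 100 : ℝ) * (1 - w * x ^ 2) = 108 / 100 * r := by
    rw [intervalIntegral.integral_const_mul, intervalIntegral.integral_sub
      (Continuous.intervalIntegrable (by fun_prop) _ _)
      (Continuous.intervalIntegrable (by fun_prop) _ _),
      intervalIntegral.integral_const_mul, integral_pow]
    simp only [intervalIntegral.integral_const, smul_eq_mul]
    push_cast
    linear_combination (-(81 / 100) * (2 / 3) * r) * hr2
  linarith

theorem rpow_neg_half_eq {w : ℝ} (hw : 0 ≤ w) : w ^ (-(1 / 2) : ℝ) = (Real.sqrt w)⁻¹ := by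
  rw [Real.rpow_neg hw, Real.sqrt_eq_rpow]

theorem sqrt_inv_sqrt {w : ℝ} (hw : 0 ≤ w) :
    Real.sqrt ((Real.sqrt w)⁻¹) = (w ^ (1 / 4 : ℝ))⁻¹ := by
  rw [Real.sqrt_inv, Real.sqrt_eq_rpow, Real.sqrt_eq_rpow, ← Real.rpow_mul hw]
  norm_num

theorem sqrt_pi_div_le {w : ℝ} (hw : 0 < w) :
    Real.sqrt (Real.pi / w) ≤ 2 * (Real.sqrt w)⁻¹ := by
  rw [Real.sqrt_div Real.pi_pos.le, div_eq_mul_inv]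
  refine mul_le_mul_of_nonneg_right ?_ (by positivity)
  rw [Real.sqrt_le_left (by norm_num)]
  linarith [Real.pi_lt_four]

namespace IsKummerZero

variable {w a : ℝ}

theorem evenSolution_sq_bounds (h : IsKummerZero w a) {x : ℝ} (hx : x ∈ Set.Icc (-1 : ℝ) 1) :
    Real.exp (-w * x ^ 2) * (1 - x ^ 2) ^ 2 ≤ evenSolution w a x ^ 2 ∧
      evenSolution w a x ^ 2 ≤ Real.exp (-w * x ^ 2) := by
  have hx1 : |x| ≤ 1 := abs_le.2 hx
  have hx2 : x ^ 2 ≤ 1 := by rwa [sq_le_one_iff_abs_le_one]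
  obtain ⟨h1, h2⟩ := h.factor_bounds hx1
  have e : evenSolution w a x ^ 2 =
      Real.exp (-w * x ^ 2) * (1 + a * kummerQuot a (w * x ^ 2)) ^ 2 := by
    rw [evenSolution, mul_pow, ← Real.exp_nat_mul]
    congr 2
    push_cast; ring
  rw [e]
  constructor
  · exact mul_le_mul_of_nonneg_left (pow_le_pow_left₀ (by linarith) h1 2) (Real.exp_pos _).le
  · exact mul_le_of_le_one_right (Real.exp_pos _).le (pow_le_one₀ (by linarith) h2)

theorem le_integral (h : IsKummerZero w a) (hw : 10 ≤ w) :
    (Real.sqrt w)⁻¹ ≤ ∫ x in (-1 : ℝ)..1, evenSolution w a x ^ 2 :=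
  inv_sqrt_le_integral hw ((continuous_evenSolution h.norm_le).pow 2)
    fun _ hx => (h.evenSolution_sq_bounds hx).1

theorem integral_le (h : IsKummerZero w a) :
    ∫ x in (-1 : ℝ)..1, evenSolution w a x ^ 2 ≤ 2 * (Real.sqrt w)⁻¹ := by
  refine le_trans ?_ ((integral_exp_neg_mul_sq_le h.pos).trans (sqrt_pi_div_le h.pos))
  refine intervalIntegral.integral_mono_on (by norm_num)
    (((continuous_evenSolution h.norm_le).pow 2).intervalIntegrable _ _)
    (Continuous.intervalIntegrable (by fun_prop) _ _)
    fun _ hx => (h.evenSolution_sq_bounds hx).2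

theorem inv_sqrt_integral_le (h : IsKummerZero w a) (hw : 10 ≤ w) :
    (Real.sqrt (∫ x in (-1 : ℝ)..1, evenSolution w a x ^ 2))⁻¹ ≤ w ^ (1 / 4 : ℝ) := by
  have h1 := Real.sqrt_le_sqrt (h.le_integral hw)
  rw [sqrt_inv_sqrt h.pos.le] at h1
  have h2 : 0 < w ^ (1 / 4 : ℝ) := Real.rpow_pos_of_pos h.pos _
  exact inv_le_of_inv_le₀ h2 h1

theorem le_inv_sqrt_integral (h : IsKummerZero w a) :
    2 / 3 * w ^ (1 / 4 : ℝ) ≤ (Real.sqrt (∫ x in (-1 : ℝ)..1, evenSolution w a x ^ 2))⁻¹ := by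
  have h1 := Real.sqrt_le_sqrt h.integral_le
  rw [Real.sqrt_mul (by norm_num), sqrt_inv_sqrt h.pos.le] at h1
  have h2 : 0 < w ^ (1 / 4 : ℝ) := Real.rpow_pos_of_pos h.pos _
  have h3 : Real.sqrt 2 ≤ 3 / 2 := by
    rw [Real.sqrt_le_left (by norm_num)]; norm_num
  rw [le_inv_comm₀ (by positivity) (Real.sqrt_pos.2 h.integral_pos)]
  refine h1.trans ?_
  rw [mul_inv]
  refine mul_le_mul_of_nonneg_right (h3.trans (by norm_num)) (by positivity)

theorem abs_firstEigenfunction_le (h : IsKummerZero w a) (hw : 10 ≤ w) {x : ℝ} (hx : |x| ≤ 1) :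
    |firstEigenfunction w x| ≤ w ^ (1 / 4 : ℝ) * Real.exp (-(w * x ^ 2 / 2)) := by
  have hx2 : x ^ 2 ≤ 1 := by rwa [sq_le_one_iff_abs_le_one]
  obtain ⟨h1, h2⟩ := h.factor_bounds hx
  have h3 := h.inv_sqrt_integral_le hw
  rw [h.firstEigenfunction_eq hx, evenSolution, abs_of_nonneg
    (mul_nonneg (by positivity) (mul_nonneg (Real.exp_pos _).le (by linarith)))]
  exact mul_le_mul h3 (mul_le_of_le_one_right (Real.exp_pos _).le h2)
    (mul_nonneg (Real.exp_pos _).le (by linarith)) (Real.rpow_nonneg h.pos.le _)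

theorem le_abs_firstEigenfunction (h : IsKummerZero w a) {x : ℝ} (hx : |x| ≤ 1 / 2) :
    1 / 2 * w ^ (1 / 4 : ℝ) * Real.exp (-(w * x ^ 2 / 2)) ≤ |firstEigenfunction w x| := by
  have hx1 : |x| ≤ 1 := by linarith
  have hx2 : x ^ 2 ≤ 1 / 4 := by
    rw [← sq_abs]; nlinarith [abs_nonneg x]
  obtain ⟨h1, h2⟩ := h.factor_bounds hx1
  have h3 := h.le_inv_sqrt_integral
  rw [h.firstEigenfunction_eq hx1, evenSolution]
  refine le_trans ?_ (le_abs_self _)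
  have hp : 0 ≤ w ^ (1 / 4 : ℝ) := Real.rpow_nonneg h.pos.le _
  -- The normalizing factor contributes `2/3` and `1 - x² ≥ 3/4` the rest.
  calc _ = (2 / 3 * w ^ (1 / 4 : ℝ)) * (Real.exp (-(w * x ^ 2 / 2)) * (3 / 4)) := by ring
    _ ≤ _ := by
      refine mul_le_mul h3 (mul_le_mul_of_nonneg_left (by linarith) (Real.exp_pos _).le)
        (by positivity) (by positivity)

/-- The Gaussian gives `e^{-w/8}` and the prefactor `w^{1/4}` costs at most `e^{w/40}`; the
exponents add up to exactly `-w/10`. -/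
theorem abs_firstEigenfunction_le_exp (h : IsKummerZero w a) (hw : 10 ≤ w)
    (he : w ≤ Real.exp (w / 10)) {x : ℝ} (hx : 1 / 2 < |x|) (hx1 : |x| ≤ 1) :
    |firstEigenfunction w x| ≤ Real.exp (-(w / 10)) := by
  refine (h.abs_firstEigenfunction_le hw hx1).trans ?_
  have h1 : w ^ (1 / 4 : ℝ) ≤ Real.exp (w / 40) := by
    calc _ ≤ (Real.exp (w / 10)) ^ (1 / 4 : ℝ) :=
          Real.rpow_le_rpow h.pos.le he (by norm_num)
      _ = _ := by rw [← Real.exp_mul]; ring_nf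
  have hx2 : 1 / 4 ≤ x ^ 2 := by
    rw [← sq_abs]; nlinarith
  have h2 : Real.exp (-(w * x ^ 2 / 2)) ≤ Real.exp (-(w / 8)) :=
    Real.exp_le_exp.2 (by nlinarith)
  calc _ ≤ Real.exp (w / 40) * Real.exp (-(w / 8)) :=
        mul_le_mul h1 h2 (Real.exp_pos _).le (Real.exp_pos _).le
    _ = _ := by rw [← Real.exp_add]; ring_nf

end IsKummerZero

/-! ### The holomorphic root -/

theorem differentiableOn_kummerCoeff {U : Set ℂ} {a : ℂ → ℂ} (ha : DifferentiableOn ℂ a U) (n : ℕ) :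
    DifferentiableOn ℂ (fun z => kummerCoeff (a z) n) U := by
  induction n with
  | zero => simp only [kummerCoeff]; fun_prop
  | succ n ih =>
    cases n with
    | zero => simp only [kummerCoeff]; fun_prop
    | succ n =>
      simp only [kummerCoeff_succ_succ]
      exact ((ha.const_add _).div_const _).mul ih

theorem differentiableOn_kummerQuot {U : Set ℂ} (hU : IsOpen U) {a ζ : ℂ → ℂ}
    (ha : DifferentiableOn ℂ a U) (hζ : DifferentiableOn ℂ ζ U) (ha1 : ∀ z ∈ U, ‖a z‖ ≤ 1)
    {R : ℝ} (hR : ∀ z ∈ U, ‖ζ z‖ ≤ R) :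
    DifferentiableOn ℂ (fun z => kummerQuot (a z) (ζ z)) U := by
  refine Complex.differentiableOn_tsum_of_summable_norm
    (u := fun n => 2 * ((2 * R) ^ n / n.factorial))
    ((Real.summable_pow_div_factorial _).mul_left _)
    (fun n => (differentiableOn_kummerCoeff ha n).mul (hζ.pow n)) hU fun n z hz => ?_
  rw [norm_mul, norm_pow]
  calc _ ≤ (2 * (2 ^ n / n.factorial : ℝ)) * R ^ n :=
        mul_le_mul (norm_kummerCoeff_le_factorial (ha1 z hz) n)
          (pow_le_pow_left₀ (norm_nonneg _) (hR z hz) n) (by positivity) (by positivity)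
    _ = _ := by rw [mul_pow]; ring

/-- The fixed point iteration for `a = -1 / kummerQuot a z`. -/
noncomputable def kummerIter {𝕜 : Type*} [RCLike 𝕜] (z : 𝕜) : ℕ → 𝕜
  | 0 => 0
  | n + 1 => -(kummerQuot (kummerIter z n) z)⁻¹

theorem kummerIter_ofReal (x : ℝ) (n : ℕ) :
    ((kummerIter x n : ℝ) : ℂ) = kummerIter (x : ℂ) n := by
  induction n with
  | zero => simp [kummerIter]
  | succ n ih =>
    simp only [kummerIter, ← ih, ← kummerQuot_ofReal]
    push_cast; rfl

/-- The zero `a` of `M(a, 1/2, z)` near the origin. -/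
noncomputable def kummerRoot (z : ℂ) : ℂ := ∑' n, (kummerIter z (n + 1) - kummerIter z n)

/-- The frequency `w` is so large that the fixed point iteration contracts near `w`. -/
structure IsLargeFrequency (w : ℝ) : Prop where
  ten_le : 10 ≤ w
  exp_le : 64 * ((w + 1 / 8) * (w + 1 / 8 + 1) * Real.exp (w + 1 / 8)) ≤ kummerQuot (0 : ℝ) w ^ 2

namespace IsLargeFrequency

variable {w : ℝ}

theorem twenty_le (h : IsLargeFrequency w) : 20 ≤ kummerQuot (0 : ℝ) w := by
  have := two_mul_le_kummerQuot (a := 0) (s := w) (by simp) (by norm_num)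
    (by linarith [h.ten_le])
  linarith [h.ten_le]

theorem norm_le {z : ℂ} (h : IsLargeFrequency w) (hz : z ∈ Metric.ball (w : ℂ) (1 / 8)) :
    ‖z‖ ≤ w + 1 / 8 := by
  rw [mem_ball_iff_norm] at hz
  have h1 : ‖z‖ ≤ ‖(w : ℂ)‖ + ‖z - w‖ := by simpa using norm_add_le (w : ℂ) (z - w)
  rw [Complex.norm_real, Real.norm_eq_abs, abs_of_nonneg (by linarith [h.ten_le])] at h1
  linarith

theorem radius_le_one (h : IsLargeFrequency w) : 2 / kummerQuot (0 : ℝ) w ≤ 1 := by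
  have := h.twenty_le
  rw [div_le_one (by linarith)]; linarith

/-- The condition `exp_le` is designed for this Lipschitz constant: inverting `Q` divides it by
about `Q(0, w)²`, which leaves a contraction. -/
theorem norm_sub_le {a b z : ℂ} (h : IsLargeFrequency w) (hz : z ∈ Metric.ball (w : ℂ) (1 / 8))
    (ha : ‖a‖ ≤ 1) (hb : ‖b‖ ≤ 1) :
    ‖kummerQuot a z - kummerQuot b z‖ ≤ ‖a - b‖ * (kummerQuot (0 : ℝ) w ^ 2 / 32) := by
  refine (norm_kummerQuot_sub_le ha hb z).trans (mul_le_mul_of_nonneg_left ?_ (norm_nonneg _))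
  have hs := h.norm_le hz
  have h2 : 2 + kummerQuot (0 : ℝ) ‖z‖ ≤ 2 * Real.exp (w + 1 / 8) :=
    (two_add_kummerQuot_le (norm_nonneg z)).trans (by gcongr)
  have h3 : 0 ≤ kummerQuot (0 : ℝ) ‖z‖ := kummerQuot_zero_nonneg (norm_nonneg z)
  have hw := h.ten_le
  calc _ ≤ (w + 1 / 8) * (w + 1 / 8 + 1) * (2 * Real.exp (w + 1 / 8)) := by gcongr
    _ ≤ _ := by linarith [h.exp_le]

/-- Moving `a` to `0` costs at most a sixteenth of `Q(0, w)`. Moving `z` to `w` multiplies `2 + Q(0,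
·)` by at most `e^{1/8} ≤ 8/7`; this is where the small radius `1/8` enters. -/
theorem norm_sub_center_le {a z : ℂ} (h : IsLargeFrequency w)
    (hz : z ∈ Metric.ball (w : ℂ) (1 / 8)) (ha : ‖a‖ ≤ 2 / kummerQuot (0 : ℝ) w) :
    ‖kummerQuot a z - (kummerQuot (0 : ℝ) w : ℝ)‖ ≤ kummerQuot (0 : ℝ) w / 2 := by
  have hG := h.twenty_le
  have hw := h.ten_le
  set G := kummerQuot (0 : ℝ) w
  have h1 := h.norm_sub_le hz (ha.trans h.radius_le_one) (norm_zero_le_one (𝕜 := ℂ))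
  have h1' : ‖kummerQuot a z - kummerQuot 0 z‖ ≤ G / 16 := by
    refine h1.trans ?_
    rw [sub_zero]
    calc _ ≤ 2 / G * (G ^ 2 / 32) := by gcongr
      _ = _ := by field_simp; norm_num
  have h2 := norm_kummerQuot_zero_sub_le (z := z) (w := (w : ℂ)) (r := w) (h := 1 / 8)
    (by simp [abs_of_nonneg (show 0 ≤ w by linarith)]) (mem_ball_iff_norm.1 hz).le
  have h3 := two_add_kummerQuot_add_le (s := w) (d := 1 / 8) (by linarith) (by norm_num)
  have h4 : Real.exp (1 / 8) ≤ 8 / 7 := by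
    have := Real.exp_bound_div_one_sub_of_interval (x := 1 / 8) (by norm_num) (by norm_num)
    refine this.trans (by norm_num)
  have h5 : ((G : ℝ) : ℂ) = kummerQuot (0 : ℂ) w := by
    have := kummerQuot_ofReal 0 w
    simpa using this
  have h6 : ‖kummerQuot 0 z - (G : ℝ)‖ ≤ 1 / 7 * (2 + G) := by
    rw [h5]
    refine h2.trans ?_
    have : Real.exp (1 / 8) * (2 + G) ≤ 8 / 7 * (2 + G) := by gcongr
    linarith
  calc _ ≤ ‖kummerQuot a z - kummerQuot 0 z‖ + ‖kummerQuot 0 z - (G : ℝ)‖ :=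
        norm_sub_le_norm_sub_add_norm_sub _ _ _
    _ ≤ _ := by linarith

theorem le_norm {a z : ℂ} (h : IsLargeFrequency w)
    (hz : z ∈ Metric.ball (w : ℂ) (1 / 8)) (ha : ‖a‖ ≤ 2 / kummerQuot (0 : ℝ) w) :
    kummerQuot (0 : ℝ) w / 2 ≤ ‖kummerQuot a z‖ := by
  have h1 := h.norm_sub_center_le hz ha
  have h2 := norm_sub_norm_le ((kummerQuot (0 : ℝ) w : ℝ) : ℂ) (kummerQuot a z)
  rw [norm_sub_rev, Complex.norm_real, Real.norm_eq_abs,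
    abs_of_nonneg (by linarith [h.twenty_le])] at h2
  linarith

theorem ne_zero {a z : ℂ} (h : IsLargeFrequency w)
    (hz : z ∈ Metric.ball (w : ℂ) (1 / 8)) (ha : ‖a‖ ≤ 2 / kummerQuot (0 : ℝ) w) :
    kummerQuot a z ≠ 0 := by
  have h1 := h.le_norm hz ha
  have h2 := h.twenty_le
  exact norm_pos_iff.1 (by linarith)

theorem norm_inv_sub_le {a b z : ℂ} (h : IsLargeFrequency w)
    (hz : z ∈ Metric.ball (w : ℂ) (1 / 8)) (ha : ‖a‖ ≤ 2 / kummerQuot (0 : ℝ) w)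
    (hb : ‖b‖ ≤ 2 / kummerQuot (0 : ℝ) w) :
    ‖(kummerQuot a z)⁻¹ - (kummerQuot b z)⁻¹‖ ≤ 1 / 2 * ‖a - b‖ := by
  have hG := h.twenty_le
  have h1 := h.norm_sub_le hz (hb.trans h.radius_le_one) (ha.trans h.radius_le_one)
  have ha' := h.le_norm hz ha
  have hb' := h.le_norm hz hb
  rw [inv_sub_inv (h.ne_zero hz ha) (h.ne_zero hz hb), norm_div, norm_mul]
  rw [norm_sub_rev b a] at h1
  set G := kummerQuot (0 : ℝ) w
  calc _ ≤ (‖a - b‖ * (G ^ 2 / 32)) / (G / 2 * (G / 2)) := by gcongr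
    _ = 1 / 8 * ‖a - b‖ := by field_simp; ring
    _ ≤ _ := by gcongr; norm_num

theorem norm_kummerIter_le {z : ℂ} (h : IsLargeFrequency w)
    (hz : z ∈ Metric.ball (w : ℂ) (1 / 8)) (n : ℕ) :
    ‖kummerIter z n‖ ≤ 2 / kummerQuot (0 : ℝ) w := by
  have hG := h.twenty_le
  induction n with
  | zero => simp only [kummerIter, norm_zero]; positivity
  | succ n ih =>
    have := h.le_norm hz ih
    rw [kummerIter, norm_neg, norm_inv, ← inv_div]
    exact inv_anti₀ (by linarith) this

theorem norm_kummerIter_succ_sub_le {z : ℂ} (h : IsLargeFrequency w)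
    (hz : z ∈ Metric.ball (w : ℂ) (1 / 8)) (n : ℕ) :
    ‖kummerIter z (n + 1) - kummerIter z n‖ ≤ 2 / kummerQuot (0 : ℝ) w * (1 / 2) ^ n := by
  induction n with
  | zero =>
    have := h.norm_kummerIter_le hz 1
    simpa [kummerIter] using this
  | succ n ih =>
    have e : kummerIter z (n + 1 + 1) - kummerIter z (n + 1) =
        (kummerQuot (kummerIter z n) z)⁻¹ - (kummerQuot (kummerIter z (n + 1)) z)⁻¹ := by
      simp only [kummerIter]; ring
    rw [e]
    refine (h.norm_inv_sub_le hz (h.norm_kummerIter_le hz _) (h.norm_kummerIter_le hz _)).trans ?_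
    rw [norm_sub_rev, pow_succ]
    linarith

theorem summable_bound (w : ℝ) :
    Summable fun n : ℕ => 2 / kummerQuot (0 : ℝ) w * (1 / 2 : ℝ) ^ n :=
  summable_geometric_two.mul_left _

theorem tendsto_kummerIter {z : ℂ} (h : IsLargeFrequency w)
    (hz : z ∈ Metric.ball (w : ℂ) (1 / 8)) :
    Filter.Tendsto (kummerIter z) Filter.atTop (nhds (kummerRoot z)) := by
  have hs : Summable fun n => kummerIter z (n + 1) - kummerIter z n :=
    Summable.of_norm_bounded (summable_bound w) (h.norm_kummerIter_succ_sub_le hz)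
  refine hs.hasSum.tendsto_sum_nat.congr fun n => ?_
  rw [Finset.sum_range_sub, kummerIter, sub_zero]

theorem norm_kummerRoot_le {z : ℂ} (h : IsLargeFrequency w)
    (hz : z ∈ Metric.ball (w : ℂ) (1 / 8)) : ‖kummerRoot z‖ ≤ 2 / kummerQuot (0 : ℝ) w :=
  le_of_tendsto (h.tendsto_kummerIter hz).norm
    (Filter.Eventually.of_forall (h.norm_kummerIter_le hz))

theorem norm_kummerRoot_le_one {z : ℂ} (h : IsLargeFrequency w)
    (hz : z ∈ Metric.ball (w : ℂ) (1 / 8)) : ‖kummerRoot z‖ ≤ 1 :=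
  (h.norm_kummerRoot_le hz).trans h.radius_le_one

theorem kummerRoot_spec {z : ℂ} (h : IsLargeFrequency w)
    (hz : z ∈ Metric.ball (w : ℂ) (1 / 8)) :
    1 + kummerRoot z * kummerQuot (kummerRoot z) z = 0 := by
  have h1 := h.tendsto_kummerIter hz
  have h2 : Filter.Tendsto (fun n => kummerIter z (n + 1)) Filter.atTop
      (nhds (-(kummerQuot (kummerRoot z) z)⁻¹)) := by
    rw [tendsto_iff_norm_sub_tendsto_zero]
    have h3 := (tendsto_iff_norm_sub_tendsto_zero.1 h1).const_mul (1 / 2)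
    rw [mul_zero] at h3
    refine squeeze_zero (fun _ => norm_nonneg _) (fun n => ?_) h3
    have e : kummerIter z (n + 1) - -(kummerQuot (kummerRoot z) z)⁻¹ =
        (kummerQuot (kummerRoot z) z)⁻¹ - (kummerQuot (kummerIter z n) z)⁻¹ := by
      simp only [kummerIter]; ring
    rw [e, norm_sub_rev (kummerIter z n)]
    exact h.norm_inv_sub_le hz (h.norm_kummerRoot_le hz) (h.norm_kummerIter_le hz n)
  have e := tendsto_nhds_unique (h1.comp (Filter.tendsto_add_atTop_nat 1)) h2
  have hne := h.ne_zero hz (h.norm_kummerRoot_le hz)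
  have : kummerRoot z * kummerQuot (kummerRoot z) z = -1 := by
    nth_rewrite 1 [e]
    rw [neg_mul, inv_mul_cancel₀ hne]
  rw [this]; ring

theorem differentiableOn_kummerIter (h : IsLargeFrequency w) (n : ℕ) :
    DifferentiableOn ℂ (fun z => kummerIter z n) (Metric.ball (w : ℂ) (1 / 8)) := by
  induction n with
  | zero => simp only [kummerIter]; fun_prop
  | succ n ih =>
    simp only [kummerIter]
    exact ((differentiableOn_kummerQuot Metric.isOpen_ball ih differentiableOn_id
      (fun z hz => (h.norm_kummerIter_le hz n).trans h.radius_le_one)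
      (fun z hz => h.norm_le hz)).inv
        fun z hz => h.ne_zero hz (h.norm_kummerIter_le hz n)).neg

/-- The root is a telescoping series of holomorphic iterates with a geometric bound uniform on the
disc. -/
theorem differentiableOn_kummerRoot (h : IsLargeFrequency w) :
    DifferentiableOn ℂ kummerRoot (Metric.ball (w : ℂ) (1 / 8)) :=
  Complex.differentiableOn_tsum_of_summable_norm (summable_bound w)
    (fun n => (h.differentiableOn_kummerIter (n + 1)).sub (h.differentiableOn_kummerIter n))
    Metric.isOpen_ball fun n _ hz => h.norm_kummerIter_succ_sub_le hz n

theorem ofReal_re_kummerRoot {x : ℝ} (h : IsLargeFrequency w)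
    (hx : (x : ℂ) ∈ Metric.ball (w : ℂ) (1 / 8)) : ((kummerRoot x).re : ℂ) = kummerRoot x := by
  have h1 := h.tendsto_kummerIter hx
  have h2 : Filter.Tendsto (fun n => (kummerIter (x : ℂ) n).im) Filter.atTop
      (nhds (kummerRoot x).im) := (Complex.continuous_im.tendsto _).comp h1
  have h3 : (kummerRoot x).im = 0 := by
    refine tendsto_nhds_unique h2 ?_
    simp only [← kummerIter_ofReal, Complex.ofReal_im]
    exact tendsto_const_nhds
  exact Complex.ext (by simp) (by simp [h3])

theorem isKummerZero {x : ℝ} (h : IsLargeFrequency w)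
    (hx : (x : ℂ) ∈ Metric.ball (w : ℂ) (1 / 8)) : IsKummerZero x (kummerRoot x).re := by
  have h1 := h.ofReal_re_kummerRoot hx
  have h2 := h.kummerRoot_spec hx
  have h3 := h.norm_kummerRoot_le hx
  rw [← h1] at h2 h3
  rw [← kummerQuot_ofReal] at h2
  rw [Complex.norm_real, Real.norm_eq_abs] at h3
  have h2' : 1 + (kummerRoot x).re * kummerQuot (kummerRoot x).re x = 0 := by exact_mod_cast h2
  set a := (kummerRoot x).re
  have hG := h.twenty_le
  have h4 : 2 / kummerQuot (0 : ℝ) w < 1 := by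
    rw [div_lt_one (by linarith)]; linarith
  have hx0 : 0 < x := by
    rw [mem_ball_iff_norm, ← Complex.ofReal_sub, Complex.norm_real, Real.norm_eq_abs, abs_lt] at hx
    linarith [h.ten_le, hx.1]
  have ha1 : -1 < a := by linarith [neg_abs_le a]
  refine ⟨hx0, ha1, ?_, h2'⟩
  -- Negativity of the root: `Q(a, x)` is positive, so `a ≥ 0` would make `1 + a Q(a, x)` positive.
  have h5 := two_mul_le_kummerQuot (s := x) (h3.trans h.radius_le_one) ha1 hx0.le
  by_contra hneg
  push Not at hneg
  have : 0 ≤ a * kummerQuot a x := mul_nonneg hneg (by linarith)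
  linarith

end IsLargeFrequency

/-! ### Cauchy estimates and integrals with a holomorphic parameter -/

section Cauchy

variable {f : ℝ → ℝ} {g : ℂ → ℂ} {w R : ℝ}

theorem iteratedDeriv_eq_re (hg : DifferentiableOn ℂ g (Metric.ball (w : ℂ) R))
    (hf : ∀ v : ℝ, (v : ℂ) ∈ Metric.ball (w : ℂ) R → f v = (g v).re) (k : ℕ) :
    ∀ v : ℝ, (v : ℂ) ∈ Metric.ball (w : ℂ) R →
      iteratedDeriv k f v = (iteratedDeriv k g v).re := by
  induction k with
  | zero => simpa using hf
  | succ k ih =>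
    intro v hv
    rw [iteratedDeriv_succ, iteratedDeriv_succ]
    have h1 : AnalyticAt ℂ (iteratedDeriv k g) v := by
      rw [iteratedDeriv_eq_iterate]
      exact (hg.analyticOnNhd Metric.isOpen_ball).iterated_deriv k v hv
    have h2 := h1.differentiableAt.hasDerivAt.real_of_complex
    have hopen : ∀ᶠ t : ℝ in nhds v, (t : ℂ) ∈ Metric.ball (w : ℂ) R :=
      (Complex.continuous_ofReal.tendsto v).eventually (Metric.isOpen_ball.mem_nhds hv)
    have h3 : iteratedDeriv k f =ᶠ[nhds v] fun t => (iteratedDeriv k g t).re := by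
      filter_upwards [hopen] with t ht using ih t ht
    rw [h3.deriv_eq, h2.deriv]

theorem contDiffAt_of_eq_re (hR : 0 < R) (hg : DifferentiableOn ℂ g (Metric.ball (w : ℂ) R))
    (hf : ∀ v : ℝ, (v : ℂ) ∈ Metric.ball (w : ℂ) R → f v = (g v).re) (n : WithTop ℕ∞) :
    ContDiffAt ℝ n f w := by
  have hw : (w : ℂ) ∈ Metric.ball (w : ℂ) R := Metric.mem_ball_self hR
  have h1 : AnalyticAt ℂ g w := hg.analyticOnNhd Metric.isOpen_ball w hw
  refine h1.re_ofReal.contDiffAt.congr_of_eventuallyEq ?_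
  filter_upwards [(Complex.continuous_ofReal.tendsto w).eventually
    (Metric.isOpen_ball.mem_nhds hw)] with t ht using hf t ht

/-- Cauchy's estimate for a real function that extends to a holomorphic function on a disc. -/
theorem abs_iteratedDeriv_le (hR : 0 < R) (hg : DifferentiableOn ℂ g (Metric.ball (w : ℂ) R))
    (hf : ∀ v : ℝ, (v : ℂ) ∈ Metric.ball (w : ℂ) R → f v = (g v).re) {B : ℝ}
    (hB : ∀ z ∈ Metric.ball (w : ℂ) R, ‖g z‖ ≤ B) (k : ℕ) :
    |iteratedDeriv k f w| ≤ k.factorial * B / (R / 2) ^ k := by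
  have hw : (w : ℂ) ∈ Metric.ball (w : ℂ) R := Metric.mem_ball_self hR
  rw [iteratedDeriv_eq_re hg hf k w hw]
  refine (Complex.abs_re_le_norm _).trans ?_
  -- Half the radius is given up because the bound on `g` is available only in the open disc.
  have hsub : Metric.closedBall (w : ℂ) (R / 2) ⊆ Metric.ball (w : ℂ) R :=
    Metric.closedBall_subset_ball (by linarith)
  refine Complex.norm_iteratedDeriv_le_of_forall_mem_sphere_norm_le k (by linarith) ?_
    fun z hz => hB z (hsub (Metric.sphere_subset_closedBall hz))
  refine DifferentiableOn.diffContOnCl (hg.mono ?_)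
  exact Metric.closure_ball_subset_closedBall.trans hsub

end Cauchy

theorem iteratedDeriv_linear_add {f : ℝ → ℝ} {w : ℝ} (hf : ContDiffAt ℝ ∞ f w) (b c : ℝ) {k : ℕ}
    (hk : 2 ≤ k) :
    iteratedDeriv k (fun v => b * v + c * f v) w = c * iteratedDeriv k f w := by
  have hfk : ContDiffAt ℝ k f w := hf.of_le (by exact_mod_cast le_top)
  have h1 : iteratedDeriv k (fun v : ℝ => b * v) = fun _ => 0 := by
    obtain ⟨m, rfl⟩ := Nat.exists_eq_add_of_le' hk
    rw [iteratedDeriv_succ', show deriv (fun v : ℝ => b * v) = fun _ => b from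
      funext fun v => by simp, iteratedDeriv_succ']
    simp only [deriv_const']
    funext v
    simp
  have h2 : ContDiffAt ℝ k (fun v : ℝ => b * v) w := by fun_prop
  have h3 : ContDiffAt ℝ k (fun v : ℝ => c * f v) w := contDiffAt_const.mul hfk
  have h4 := iteratedDeriv_add h2 h3
  have e : ((fun v : ℝ => b * v) + fun v => c * f v) = fun v => b * v + c * f v := rfl
  rw [e, h1, iteratedDeriv_const_mul c hfk] at h4
  simpa using h4

/-- An integral depending holomorphically on a parameter. -/
theorem differentiableOn_integral_of_bounded {K : ℂ → ℝ → ℂ} {c : ℂ} {R B : ℝ}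
    (hK : ∀ x ∈ Set.Icc (-1 : ℝ) 1, DifferentiableOn ℂ (fun z => K z x) (Metric.ball c R))
    (hc : ∀ z ∈ Metric.ball c R, Continuous (K z))
    (hB : ∀ x ∈ Set.Icc (-1 : ℝ) 1, ∀ z ∈ Metric.ball c R, ‖K z x‖ ≤ B) :
    DifferentiableOn ℂ (fun z => ∫ x in (-1 : ℝ)..1, K z x) (Metric.ball c R) := by
  intro z₀ hz₀
  obtain ⟨r, hr, hsub⟩ := Metric.isOpen_iff.1 Metric.isOpen_ball z₀ hz₀
  have hIoc : ∀ x ∈ Set.uIoc (-1 : ℝ) 1, x ∈ Set.Icc (-1 : ℝ) 1 := by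
    intro x hx
    rw [Set.uIoc_of_le (by norm_num)] at hx
    exact ⟨hx.1.le, hx.2⟩
  have hd : ∀ x ∈ Set.Icc (-1 : ℝ) 1, ∀ z ∈ Metric.ball c R,
      HasDerivAt (fun z => K z x) (deriv (fun z => K z x) z) z := fun x hx z hz =>
    ((hK x hx).differentiableAt (Metric.isOpen_ball.mem_nhds hz)).hasDerivAt
  have h := intervalIntegral.hasDerivAt_integral_of_dominated_loc_of_deriv_le
    (μ := MeasureTheory.volume) (a := -1) (b := 1) (F := K)
    (F' := fun z x => deriv (fun z => K z x) z) (x₀ := z₀) (s := Metric.ball z₀ (r / 2))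
    (bound := fun _ => B / (r / 4)) (Metric.ball_mem_nhds z₀ (by linarith)) ?_
    ((hc z₀ hz₀).intervalIntegrable _ _) ?_ ?_ intervalIntegrable_const ?_
  · exact h.2.differentiableAt.differentiableWithinAt
  · filter_upwards [Metric.isOpen_ball.mem_nhds hz₀] with z hz
    exact (hc z hz).aestronglyMeasurable
  -- Measurability in `x` of the `z`-derivative: it is the pointwise limit of difference quotients
  -- along this sequence, each continuous in `x`.
  · set u : ℕ → ℂ := fun n => z₀ + ((r / 2 * (1 / 2) ^ n : ℝ) : ℂ) with hu
    have hun : ∀ n, u n ∈ Metric.ball z₀ r := by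
      intro n
      rw [mem_ball_iff_norm, hu]
      simp only [add_sub_cancel_left, Complex.norm_real, Real.norm_eq_abs]
      rw [abs_of_nonneg (by positivity)]
      have : (1 / 2 : ℝ) ^ n ≤ 1 := pow_le_one₀ (by norm_num) (by norm_num)
      nlinarith
    have hne : ∀ n, u n ≠ z₀ := by
      intro n he
      have : ((r / 2 * (1 / 2) ^ n : ℝ) : ℂ) = 0 := by
        have h2 : z₀ + ((r / 2 * (1 / 2) ^ n : ℝ) : ℂ) = z₀ := he
        simpa only [add_eq_left] using h2
      rw [Complex.ofReal_eq_zero] at this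
      have h2 : 0 < r / 2 * (1 / 2) ^ n := by positivity
      linarith
    have hut : Filter.Tendsto u Filter.atTop (nhdsWithin z₀ {z₀}ᶜ) := by
      refine tendsto_nhdsWithin_iff.2 ⟨?_, Filter.Eventually.of_forall hne⟩
      have h1 : Filter.Tendsto (fun n : ℕ => r / 2 * (1 / 2 : ℝ) ^ n) Filter.atTop (nhds 0) := by
        simpa using (tendsto_pow_atTop_nhds_zero_of_lt_one (r := (1 / 2 : ℝ)) (by norm_num)
          (by norm_num)).const_mul (r / 2)
      have h2 := ((Complex.continuous_ofReal.tendsto 0).comp h1).const_add z₀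
      rw [Complex.ofReal_zero, add_zero] at h2
      exact h2
    refine aestronglyMeasurable_of_tendsto_ae Filter.atTop
      (f := fun n x => slope (fun z => K z x) z₀ (u n)) (fun n => ?_) ?_
    · have : Continuous fun x => slope (fun z => K z x) z₀ (u n) := by
        simp only [slope_def_field]
        exact ((hc _ (hsub (hun n))).sub (hc _ hz₀)).div_const _
      exact this.aestronglyMeasurable
    · refine (MeasureTheory.ae_restrict_iff' measurableSet_uIoc).2
        (Filter.Eventually.of_forall fun x hx => ?_)
      exact (hasDerivAt_iff_tendsto_slope.1 (hd x (hIoc x hx) z₀ hz₀)).comp hut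
  -- Cauchy's estimate on discs of radius `r/4` converts the uniform bound on `K` into a dominating
  -- constant for its derivative.
  · refine Filter.Eventually.of_forall fun x hx z hz => ?_
    have hsub2 : Metric.closedBall z (r / 4) ⊆ Metric.ball c R := by
      refine Set.Subset.trans ?_ hsub
      intro t ht
      rw [Metric.mem_closedBall] at ht
      rw [Metric.mem_ball] at hz ⊢
      linarith [dist_triangle t z z₀]
    refine Complex.norm_deriv_le_of_forall_mem_sphere_norm_le (by linarith) ?_
      fun t ht => hB x (hIoc x hx) t (hsub2 (Metric.sphere_subset_closedBall ht))
    exact DifferentiableOn.diffContOnCl ((hK x (hIoc x hx)).mono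
      (Metric.closure_ball_subset_closedBall.trans hsub2))
  · refine Filter.Eventually.of_forall fun x hx z hz => hd x (hIoc x hx) z (hsub ?_)
    exact Metric.ball_subset_ball (by linarith) hz

/-! ### The power `-1/2` on a right half-plane -/

section InvSqrt

theorem norm_cpow_neg_half_le {ζ : ℂ} {m : ℝ} (hm : 0 < m) (h : m ≤ ζ.re) :
    ‖ζ ^ ((-(1 / 2) : ℝ) : ℂ)‖ ≤ m ^ (-(1 / 2) : ℝ) := by
  rw [Complex.norm_cpow_real]
  exact Real.rpow_le_rpow_of_nonpos hm (h.trans ((le_abs_self _).trans (Complex.abs_re_le_norm ζ)))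
    (by norm_num)

theorem norm_cpow_neg_half_sub_le {ζ ξ : ℂ} {m : ℝ} (hm : 0 < m) (h : m ≤ ζ.re) (h' : m ≤ ξ.re) :
    ‖ζ ^ ((-(1 / 2) : ℝ) : ℂ) - ξ ^ ((-(1 / 2) : ℝ) : ℂ)‖ ≤
      1 / 2 * m ^ (-(3 / 2) : ℝ) * ‖ζ - ξ‖ := by
  have hconv : Convex ℝ {z : ℂ | m ≤ z.re} := convex_halfSpace_re_ge m
  refine hconv.norm_image_sub_le_of_norm_hasDerivWithin_le (𝕜 := ℂ)
    (f := fun z : ℂ => z ^ ((-(1 / 2) : ℝ) : ℂ))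
    (f' := fun z : ℂ => ((-(1 / 2) : ℝ) : ℂ) * z ^ ((-(3 / 2) : ℝ) : ℂ)) ?_ ?_ h' h
  · intro z hz
    have hz' : z ∈ Complex.slitPlane := Or.inl (hm.trans_le hz)
    have := (hasDerivAt_id z).cpow_const (c := ((-(1 / 2) : ℝ) : ℂ)) hz'
    refine (this.congr_deriv ?_).hasDerivWithinAt
    rw [mul_one, show ((-(1 / 2) : ℝ) : ℂ) - 1 = ((-(3 / 2) : ℝ) : ℂ) by push_cast; ring]
    rfl
  · intro z hz
    rw [norm_mul, Complex.norm_cpow_real, Complex.norm_real, Real.norm_eq_abs,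
      show |(-(1 / 2) : ℝ)| = 1 / 2 by norm_num]
    refine mul_le_mul_of_nonneg_left ?_ (by norm_num)
    exact Real.rpow_le_rpow_of_nonpos hm
      (le_trans hz ((le_abs_self _).trans (Complex.abs_re_le_norm z))) (by norm_num)

theorem DifferentiableOn.cpow_neg_half {U : Set ℂ} {g : ℂ → ℂ} (hg : DifferentiableOn ℂ g U)
    (hre : ∀ z ∈ U, 0 < (g z).re) :
    DifferentiableOn ℂ (fun z => g z ^ ((-(1 / 2) : ℝ) : ℂ)) U :=
  hg.cpow_const fun z hz => Or.inl (hre z hz)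

end InvSqrt

/-! ### The normalized Gaussian on a disc of radius `w / 40` -/

/-- `∫ exp (-z x²)` over `[-1, 1]`. -/
noncomputable def gaussIntegral (z : ℂ) : ℂ := ∫ x in (-1 : ℝ)..1, Complex.exp (-(z * x ^ 2))

theorem norm_exp_neg_mul_sq (z : ℂ) (x : ℝ) :
    ‖Complex.exp (-(z * x ^ 2))‖ = Real.exp (-z.re * x ^ 2) := by
  rw [Complex.norm_exp]
  congr 1
  rw [show -(z * (x : ℂ) ^ 2) = ((-(x ^ 2) : ℝ) : ℂ) * z by push_cast; ring, Complex.re_ofReal_mul]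
  ring

theorem norm_exp_neg_mul_sq_half (z : ℂ) (x : ℝ) :
    ‖Complex.exp (-(z * x ^ 2 / 2))‖ = Real.exp (-z.re * x ^ 2 / 2) := by
  have e : -(z * x ^ 2 / 2) = -((z / 2) * x ^ 2) := by ring
  rw [e, norm_exp_neg_mul_sq]
  congr 1
  have : (z / 2).re = z.re / 2 := by
    rw [show (2 : ℂ) = ((2 : ℝ) : ℂ) by norm_num, Complex.div_ofReal_re]
  rw [this]; ring

theorem norm_exp_half_le_one {z : ℂ} (hz : 0 ≤ z.re) (x : ℝ) :
    ‖Complex.exp (-(z * x ^ 2 / 2))‖ ≤ 1 := by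
  rw [norm_exp_neg_mul_sq_half, Real.exp_le_one_iff]
  nlinarith [mul_nonneg hz (sq_nonneg x)]

theorem re_ge_of_mem_ball {w R : ℝ} {z : ℂ} (hz : z ∈ Metric.ball (w : ℂ) R) : w - R ≤ z.re := by
  rw [mem_ball_iff_norm] at hz
  have := (Complex.abs_re_le_norm (z - w)).trans hz.le
  rw [Complex.sub_re, Complex.ofReal_re] at this
  linarith [neg_abs_le (z.re - w)]

theorem differentiableOn_gaussIntegral {w R : ℝ} (hR : R ≤ w) :
    DifferentiableOn ℂ gaussIntegral (Metric.ball (w : ℂ) R) := by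
  refine differentiableOn_integral_of_bounded (K := fun z x => Complex.exp (-(z * x ^ 2)))
    (B := 1) (fun x _ => by fun_prop) (fun z _ => by fun_prop) fun x _ z hz => ?_
  rw [norm_exp_neg_mul_sq, Real.exp_le_one_iff]
  have := re_ge_of_mem_ball hz
  nlinarith [sq_nonneg x]

theorem norm_exp_sub_exp_le {w : ℝ} (hw : 0 ≤ w) {z : ℂ} (hz : ‖z - w‖ ≤ w / 40) (x : ℝ) :
    ‖Complex.exp (-(z * x ^ 2)) - Complex.exp (-(w * x ^ 2))‖ ≤
      1 / 19 * Real.exp (-(w / 2) * x ^ 2) := by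
  set t := w * x ^ 2 with ht
  have ht0 : 0 ≤ t := by positivity
  set u : ℂ := -((z - w) * x ^ 2) with hu
  have hun : ‖u‖ ≤ t / 40 := by
    rw [hu, norm_neg, norm_mul, norm_pow, Complex.norm_real, Real.norm_eq_abs, sq_abs]
    calc _ ≤ w / 40 * x ^ 2 := by gcongr
      _ = _ := by rw [ht]; ring
  have e : Complex.exp (-(z * x ^ 2)) - Complex.exp (-(w * x ^ 2)) =
      Complex.exp (-(w * x ^ 2)) * (Complex.exp u - 1) := by
    rw [mul_sub, ← Complex.exp_add, mul_one, hu]; ring_nf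
  have h1 : ‖Complex.exp u - 1‖ ≤ t / 40 * Real.exp (t / 40) := by
    have := Complex.norm_exp_sub_sum_le_norm_mul_exp u 1
    simp only [Finset.range_one, Finset.sum_singleton, pow_zero, Nat.factorial_zero, Nat.cast_one,
      div_one, pow_one] at this
    exact this.trans (by gcongr)
  -- The factor `t` is traded for `e^{19t/40}`; together with `e^{t/40}` and `e^{-t}` this leaves
  -- `e^{-t/2}`.
  have h2 : t ≤ 40 / 19 * Real.exp (19 / 40 * t) := by
    have := Real.add_one_le_exp (19 / 40 * t); linarith
  rw [e, norm_mul, norm_exp_neg_mul_sq, Complex.ofReal_re]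
  calc _ ≤ Real.exp (-t) * (40 / 19 * Real.exp (19 / 40 * t) / 40 * Real.exp (t / 40)) := by
        rw [show -w * x ^ 2 = -t by rw [ht]; ring]
        refine mul_le_mul_of_nonneg_left (h1.trans ?_) (Real.exp_pos _).le
        gcongr
    _ = 1 / 19 * (Real.exp (-t) * Real.exp (19 / 40 * t) * Real.exp (t / 40)) := by ring
    _ = _ := by
        rw [← Real.exp_add, ← Real.exp_add, ht]
        congr 2; ring

/-- At the centre the integral is at least `w^{-1/2}`, and moving to `z` changes it by at most
`3/19` of that. A positive real part makes the principal power `-1/2` holomorphic on a disc of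
radius proportional to `w`. -/
theorem re_gaussIntegral_ge {w : ℝ} (hw : 10 ≤ w) {z : ℂ} (hz : z ∈ Metric.ball (w : ℂ) (w / 40)) :
    1 / 2 * (Real.sqrt w)⁻¹ ≤ (gaussIntegral z).re := by
  have hw0 : 0 < w := by linarith
  have h1 : (Real.sqrt w)⁻¹ ≤ ∫ x in (-1 : ℝ)..1, Real.exp (-(w * x ^ 2)) := by
    refine inv_sqrt_le_integral hw (by fun_prop) fun x hx => ?_
    have hx2 : x ^ 2 ≤ 1 := by rw [sq_le_one_iff_abs_le_one]; exact abs_le.2 hx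
    rw [← neg_mul]
    exact mul_le_of_le_one_right (Real.exp_pos _).le
      (pow_le_one₀ (by linarith) (by linarith [sq_nonneg x]))
  have h2 : gaussIntegral w = ((∫ x in (-1 : ℝ)..1, Real.exp (-(w * x ^ 2)) : ℝ) : ℂ) := by
    rw [← intervalIntegral.integral_ofReal, gaussIntegral]
    push_cast; rfl
  have h3 : ‖gaussIntegral z - gaussIntegral w‖ ≤ 1 / 19 * (3 * (Real.sqrt w)⁻¹) := by
    rw [gaussIntegral, gaussIntegral, ← intervalIntegral.integral_sub
      (Continuous.intervalIntegrable (by fun_prop) _ _)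
      (Continuous.intervalIntegrable (by fun_prop) _ _)]
    have h4 := intervalIntegral.norm_integral_le_of_norm_le
      (f := fun x : ℝ => Complex.exp (-(z * x ^ 2)) - Complex.exp (-(w * x ^ 2)))
      (g := fun x : ℝ => 1 / 19 * Real.exp (-(w / 2) * x ^ 2)) (a := -1) (b := 1)
      (μ := MeasureTheory.volume) (by norm_num)
      (Filter.Eventually.of_forall fun x _ =>
        norm_exp_sub_exp_le hw0.le (mem_ball_iff_norm.1 hz).le x)
      (Continuous.intervalIntegrable (by fun_prop) _ _)
    refine h4.trans ?_
    rw [intervalIntegral.integral_const_mul]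
    refine mul_le_mul_of_nonneg_left ?_ (by norm_num)
    refine (integral_exp_neg_mul_sq_le (b := w / 2) (by linarith)).trans
      ((sqrt_pi_div_le (by linarith)).trans ?_)
    rw [Real.sqrt_div hw0.le, inv_div, div_eq_mul_inv, ← mul_assoc]
    refine mul_le_mul_of_nonneg_right ?_ (by positivity)
    have : Real.sqrt 2 ≤ 3 / 2 := by rw [Real.sqrt_le_left (by norm_num)]; norm_num
    linarith
  have h5 := (Complex.abs_re_le_norm (gaussIntegral z - gaussIntegral w)).trans h3
  rw [Complex.sub_re, h2, Complex.ofReal_re] at h5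
  have h6 := neg_abs_le ((gaussIntegral z).re - ∫ x in (-1 : ℝ)..1, Real.exp (-(w * x ^ 2)))
  have : 0 < (Real.sqrt w)⁻¹ := inv_pos.2 (Real.sqrt_pos.2 hw0)
  linarith

/-- The holomorphic extension in `z` of the normalized Gaussian `exp (-z x² / 2)` on `[-1, 1]`. -/
noncomputable def gaussFunction (z : ℂ) (x : ℝ) : ℂ :=
  gaussIntegral z ^ ((-(1 / 2) : ℝ) : ℂ) * Complex.exp (-(z * x ^ 2 / 2))

theorem rpow_quarter_inv_sqrt {w : ℝ} (hw : 0 ≤ w) :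
    (1 / 4 * (Real.sqrt w)⁻¹) ^ (-(1 / 2) : ℝ) = 2 * w ^ (1 / 4 : ℝ) := by
  rw [rpow_neg_half_eq (by positivity), Real.sqrt_mul (by norm_num), sqrt_inv_sqrt hw,
    show (1 / 4 : ℝ) = (1 / 2) ^ 2 by norm_num, Real.sqrt_sq (by norm_num), mul_inv, inv_inv]
  norm_num

theorem rpow_quarter_inv_sqrt' {w : ℝ} (hw : 0 ≤ w) :
    (1 / 4 * (Real.sqrt w)⁻¹) ^ (-(3 / 2) : ℝ) = 8 * w ^ (3 / 4 : ℝ) := by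
  have e : (1 / 4 * (Real.sqrt w)⁻¹) ^ (-(3 / 2) : ℝ) =
      ((1 / 4 * (Real.sqrt w)⁻¹) ^ (-(1 / 2) : ℝ)) ^ (3 : ℝ) := by
    rw [← Real.rpow_mul (by positivity)]; norm_num
  rw [e, rpow_quarter_inv_sqrt hw, Real.mul_rpow (by norm_num) (by positivity),
    ← Real.rpow_mul hw]
  norm_num

section Gauss

variable {w : ℝ}

theorem differentiableOn_gaussFunction (hw : 10 ≤ w) (x : ℝ) :
    DifferentiableOn ℂ (fun z => gaussFunction z x) (Metric.ball (w : ℂ) (w / 40)) := by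
  refine DifferentiableOn.mul ((differentiableOn_gaussIntegral (by linarith)).cpow_neg_half
    fun z hz => ?_) (by fun_prop)
  refine lt_of_lt_of_le ?_ (re_gaussIntegral_ge hw hz)
  have : 0 < Real.sqrt w := Real.sqrt_pos.2 (by linarith)
  positivity

theorem norm_gaussFunction_le (hw : 10 ≤ w) (x : ℝ) {z : ℂ}
    (hz : z ∈ Metric.ball (w : ℂ) (w / 40)) :
    ‖gaussFunction z x‖ ≤ 2 * w ^ (1 / 4 : ℝ) := by
  have hs : 0 < (Real.sqrt w)⁻¹ := inv_pos.2 (Real.sqrt_pos.2 (by linarith))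
  have h1 := norm_cpow_neg_half_le (m := 1 / 4 * (Real.sqrt w)⁻¹) (by positivity)
    ((by linarith : 1 / 4 * (Real.sqrt w)⁻¹ ≤ 1 / 2 * (Real.sqrt w)⁻¹).trans
      (re_gaussIntegral_ge hw hz))
  rw [rpow_quarter_inv_sqrt (by linarith)] at h1
  have h2 := norm_exp_half_le_one (z := z) (by linarith [re_ge_of_mem_ball hz]) x
  rw [gaussFunction, norm_mul]
  calc _ ≤ 2 * w ^ (1 / 4 : ℝ) * 1 :=
        mul_le_mul h1 h2 (norm_nonneg _) ((norm_nonneg _).trans h1)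
    _ = _ := mul_one _

end Gauss

/-! ### The holomorphic ground state and its distance from the Gaussian -/

/-- The correction `M(a, 1/2, z x²) - 1` at `a = kummerRoot z`. -/
noncomputable def kummerCorrection (z : ℂ) (x : ℝ) : ℂ :=
  kummerRoot z * kummerQuot (kummerRoot z) (z * x ^ 2)

/-- The holomorphic extension in `w` of the squared norm of the ground state. -/
noncomputable def groundIntegral (z : ℂ) : ℂ :=
  ∫ x in (-1 : ℝ)..1, Complex.exp (-(z * x ^ 2)) * (1 + kummerCorrection z x) ^ 2

/-- The holomorphic extension in `w` of the normalized ground state. -/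
noncomputable def groundFunction (z : ℂ) (x : ℝ) : ℂ :=
  groundIntegral z ^ ((-(1 / 2) : ℝ) : ℂ) *
    (Complex.exp (-(z * x ^ 2 / 2)) * (1 + kummerCorrection z x))

/-- The size of `kummerCorrection` near the origin. -/
noncomputable def correctionSize (w : ℝ) : ℝ := 4 * (w + 1 / 8) / kummerQuot (0 : ℝ) w

/-- A bound for `groundIntegral - gaussIntegral`. -/
noncomputable def integralError (w : ℝ) : ℝ :=
  8 * correctionSize w + 4 * correctionSize w ^ 2 * Real.exp (w + 1 / 8)

namespace IsLargeFrequency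

variable {w : ℝ} {z : ℂ}

theorem correctionSize_nonneg (h : IsLargeFrequency w) : 0 ≤ correctionSize w := by
  have := h.twenty_le
  have := h.ten_le
  unfold correctionSize
  positivity

theorem norm_mul_sq_le (h : IsLargeFrequency w) (hz : z ∈ Metric.ball (w : ℂ) (1 / 8)) (x : ℝ) :
    ‖z * (x : ℂ) ^ 2‖ ≤ (w + 1 / 8) * x ^ 2 := by
  rw [norm_mul, norm_pow, Complex.norm_real, Real.norm_eq_abs, sq_abs]
  exact mul_le_mul_of_nonneg_right (h.norm_le hz) (sq_nonneg x)

theorem norm_kummerCorrection_le (h : IsLargeFrequency w)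
    (hz : z ∈ Metric.ball (w : ℂ) (1 / 8)) {x : ℝ} (hx : x ^ 2 ≤ 1) :
    ‖kummerCorrection z x‖ ≤ correctionSize w * Real.exp ((w + 1 / 8) * x ^ 2) := by
  have hw := h.ten_le
  have hG := h.twenty_le
  have h1 := norm_kummerQuot_le (h.norm_kummerRoot_le_one hz) (z * (x : ℂ) ^ 2)
  have h2 := h.norm_mul_sq_le hz x
  have h3 := two_add_kummerQuot_le (norm_nonneg (z * (x : ℂ) ^ 2))
  have h4 : (w + 1 / 8) * x ^ 2 ≤ w + 1 / 8 := mul_le_of_le_one_right (by linarith) hx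
  have h5 := kummerQuot_zero_nonneg (norm_nonneg (z * (x : ℂ) ^ 2))
  rw [kummerCorrection, norm_mul]
  calc _ ≤ 2 / kummerQuot (0 : ℝ) w *
        ((w + 1 / 8) * (2 * Real.exp ((w + 1 / 8) * x ^ 2))) := by
        refine mul_le_mul (h.norm_kummerRoot_le hz) (h1.trans ?_) (norm_nonneg _) (by positivity)
        refine mul_le_mul (h2.trans h4) (h3.trans ?_) (by linarith) (by linarith)
        gcongr
    _ = _ := by unfold correctionSize; ring

/-- In `(1 + k)² - 1 = 2k + k²` the correction `k` is at most `q e^{(w + 1/8) x²}`. The Gaussian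
cancels the growth of the linear term; the quadratic term keeps one factor `e^{w x²}`, harmless
because `q²` is of order `e^{-2w}` up to powers of `w`. -/
theorem norm_integrand_sub_le (h : IsLargeFrequency w)
    (hz : z ∈ Metric.ball (w : ℂ) (1 / 8)) {x : ℝ} (hx : x ^ 2 ≤ 1) :
    ‖Complex.exp (-(z * x ^ 2)) * (1 + kummerCorrection z x) ^ 2 - Complex.exp (-(z * x ^ 2))‖ ≤
      4 * correctionSize w + 2 * correctionSize w ^ 2 * Real.exp (w + 1 / 8) := by
  have hq := h.correctionSize_nonneg
  have hb := h.norm_kummerCorrection_le hz hx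
  have hre := re_ge_of_mem_ball hz
  have hx0 := sq_nonneg x
  have hw := h.ten_le
  set q := correctionSize w
  set k := kummerCorrection z x
  have he : Real.exp (1 / 4) ≤ 2 := by
    have := Real.exp_bound_div_one_sub_of_interval (x := 1 / 4) (by norm_num) (by norm_num)
    exact this.trans (by norm_num)
  have h1 : ‖Complex.exp (-(z * x ^ 2))‖ ≤ Real.exp (-(w - 1 / 8) * x ^ 2) := by
    rw [norm_exp_neg_mul_sq]
    exact Real.exp_le_exp.2 (by nlinarith)
  have e : Complex.exp (-(z * x ^ 2)) * (1 + k) ^ 2 - Complex.exp (-(z * x ^ 2)) =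
      Complex.exp (-(z * x ^ 2)) * (2 * k + k ^ 2) := by ring
  have h2 : ‖2 * k + k ^ 2‖ ≤ 2 * (q * Real.exp ((w + 1 / 8) * x ^ 2)) +
      (q * Real.exp ((w + 1 / 8) * x ^ 2)) ^ 2 := by
    refine (norm_add_le _ _).trans ?_
    rw [norm_mul, norm_pow, Complex.norm_ofNat]
    gcongr
  rw [e, norm_mul]
  calc _ ≤ Real.exp (-(w - 1 / 8) * x ^ 2) * (2 * (q * Real.exp ((w + 1 / 8) * x ^ 2)) +
        (q * Real.exp ((w + 1 / 8) * x ^ 2)) ^ 2) := by gcongr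
    _ = 2 * q * Real.exp (1 / 4 * x ^ 2) + q ^ 2 * Real.exp ((w + 3 / 8) * x ^ 2) := by
        have e1 : Real.exp (1 / 4 * x ^ 2) =
            Real.exp (-(w - 1 / 8) * x ^ 2) * Real.exp ((w + 1 / 8) * x ^ 2) := by
          rw [← Real.exp_add]; ring_nf
        have e2 : Real.exp ((w + 3 / 8) * x ^ 2) = Real.exp (-(w - 1 / 8) * x ^ 2) *
            (Real.exp ((w + 1 / 8) * x ^ 2)) ^ 2 := by
          rw [← Real.exp_nat_mul, ← Real.exp_add]
          congr 1; push_cast; ring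
        rw [e1, e2]; ring
    _ ≤ 2 * q * Real.exp (1 / 4) + q ^ 2 * Real.exp (w + 1 / 8 + 1 / 4) := by
        gcongr
        · linarith
        · nlinarith
    _ ≤ _ := by
        rw [Real.exp_add (w + 1 / 8)]
        have : q ^ 2 * (Real.exp (w + 1 / 8) * Real.exp (1 / 4)) ≤
            q ^ 2 * (Real.exp (w + 1 / 8) * 2) := by gcongr
        nlinarith

theorem continuous_kummerCorrection (h : IsLargeFrequency w)
    (hz : z ∈ Metric.ball (w : ℂ) (1 / 8)) : Continuous (kummerCorrection z) := by
  have h1 : Continuous (kummerQuot (kummerRoot z)) := continuous_iff_continuousAt.2 fun t =>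
    (hasDerivAt_kummerQuot (h.norm_kummerRoot_le_one hz) t).continuousAt
  exact continuous_const.mul (h1.comp (by fun_prop))

theorem differentiableOn_kummerCorrection (h : IsLargeFrequency w) (x : ℝ) :
    DifferentiableOn ℂ (fun z => kummerCorrection z x) (Metric.ball (w : ℂ) (1 / 8)) :=
  h.differentiableOn_kummerRoot.mul (differentiableOn_kummerQuot Metric.isOpen_ball
    h.differentiableOn_kummerRoot (by fun_prop) (fun _ hz => h.norm_kummerRoot_le_one hz)
    fun _ hz => h.norm_mul_sq_le hz x)

theorem continuous_groundIntegrand (h : IsLargeFrequency w)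
    (hz : z ∈ Metric.ball (w : ℂ) (1 / 8)) :
    Continuous fun x : ℝ => Complex.exp (-(z * x ^ 2)) * (1 + kummerCorrection z x) ^ 2 := by
  have := h.continuous_kummerCorrection hz
  fun_prop

theorem differentiableOn_groundIntegral (h : IsLargeFrequency w) :
    DifferentiableOn ℂ groundIntegral (Metric.ball (w : ℂ) (1 / 8)) := by
  refine differentiableOn_integral_of_bounded
    (K := fun z x => Complex.exp (-(z * x ^ 2)) * (1 + kummerCorrection z x) ^ 2)
    (B := 4 * correctionSize w + 2 * correctionSize w ^ 2 * Real.exp (w + 1 / 8) + 1)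
    (fun x _ => DifferentiableOn.mul (by fun_prop)
      (((h.differentiableOn_kummerCorrection x).const_add 1).pow 2))
    (fun z hz => h.continuous_groundIntegrand hz) fun x hx z hz => ?_
  have hx2 : x ^ 2 ≤ 1 := by rw [sq_le_one_iff_abs_le_one]; exact abs_le.2 hx
  have h1 := h.norm_integrand_sub_le hz hx2
  have h2 : ‖Complex.exp (-(z * x ^ 2))‖ ≤ 1 := by
    rw [norm_exp_neg_mul_sq, Real.exp_le_one_iff]
    nlinarith [re_ge_of_mem_ball hz, sq_nonneg x, h.ten_le]
  have h3 := norm_le_norm_sub_add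
    (Complex.exp (-(z * x ^ 2)) * (1 + kummerCorrection z x) ^ 2) (Complex.exp (-(z * x ^ 2)))
  linarith

theorem norm_groundIntegral_sub_le (h : IsLargeFrequency w)
    (hz : z ∈ Metric.ball (w : ℂ) (1 / 8)) :
    ‖groundIntegral z - gaussIntegral z‖ ≤ integralError w := by
  rw [groundIntegral, gaussIntegral, ← intervalIntegral.integral_sub
    ((h.continuous_groundIntegrand hz).intervalIntegrable _ _)
    (Continuous.intervalIntegrable (by fun_prop) _ _)]
  refine (intervalIntegral.norm_integral_le_of_norm_le_const (a := -1) (b := 1)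
    (C := 4 * correctionSize w + 2 * correctionSize w ^ 2 * Real.exp (w + 1 / 8))
    fun x hx => ?_).trans (le_of_eq ?_)
  · rw [Set.uIoc_of_le (by norm_num)] at hx
    exact h.norm_integrand_sub_le hz
      (by rw [sq_le_one_iff_abs_le_one]; exact abs_le.2 ⟨hx.1.le, hx.2⟩)
  · rw [integralError, show |(1 : ℝ) - -1| = 2 by norm_num]; ring

end IsLargeFrequency

/-- The frequency `w` is so large that the ground state is close to a Gaussian near `w`. -/
structure IsGaussianFrequency (w : ℝ) : Prop extends IsLargeFrequency w where
  error_le : w ^ 3 * (4 * integralError w +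
    2 * (correctionSize w * Real.exp ((w + 1 / 8) / 4))) ≤ 1

namespace IsGaussianFrequency

variable {w : ℝ} {z : ℂ}

theorem integralError_nonneg (h : IsGaussianFrequency w) : 0 ≤ integralError w := by
  have := h.correctionSize_nonneg
  unfold integralError
  positivity

theorem integralError_le (h : IsGaussianFrequency w) :
    integralError w ≤ 1 / 4 * (Real.sqrt w)⁻¹ := by
  have hw := h.ten_le
  have h1 := h.error_le
  have hq := h.correctionSize_nonneg
  have he := h.integralError_nonneg
  have hs : 0 < Real.sqrt w := Real.sqrt_pos.2 (by linarith)
  have hsw : Real.sqrt w ≤ w ^ 3 := by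
    rw [Real.sqrt_le_left (by positivity)]
    calc w = w ^ 1 := (pow_one w).symm
      _ ≤ w ^ 6 := pow_le_pow_right₀ (by linarith) (by norm_num)
      _ = _ := by ring
  rw [← div_eq_mul_inv, le_div_iff₀ hs]
  have h2 : 0 ≤ w ^ 3 * (2 * (correctionSize w * Real.exp ((w + 1 / 8) / 4))) := by positivity
  have h3 : integralError w * Real.sqrt w ≤ integralError w * w ^ 3 := by gcongr
  nlinarith

theorem ball_subset (h : IsGaussianFrequency w) :
    Metric.ball (w : ℂ) (1 / 8) ⊆ Metric.ball (w : ℂ) (w / 40) :=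
  Metric.ball_subset_ball (by linarith [h.ten_le])

theorem re_gaussIntegral_ge (h : IsGaussianFrequency w)
    (hz : z ∈ Metric.ball (w : ℂ) (1 / 8)) :
    1 / 4 * (Real.sqrt w)⁻¹ ≤ (gaussIntegral z).re := by
  have h1 := _root_.re_gaussIntegral_ge h.ten_le (h.ball_subset hz)
  have : 0 ≤ (Real.sqrt w)⁻¹ := by positivity
  linarith

theorem re_groundIntegral_ge (h : IsGaussianFrequency w)
    (hz : z ∈ Metric.ball (w : ℂ) (1 / 8)) :
    1 / 4 * (Real.sqrt w)⁻¹ ≤ (groundIntegral z).re := by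
  have h1 := _root_.re_gaussIntegral_ge h.ten_le (h.ball_subset hz)
  have h2 := (Complex.abs_re_le_norm _).trans (h.norm_groundIntegral_sub_le hz)
  rw [Complex.sub_re] at h2
  have h3 := h.integralError_le
  linarith [neg_abs_le ((groundIntegral z).re - (gaussIntegral z).re)]

theorem lower_pos (h : IsGaussianFrequency w) : 0 < 1 / 4 * (Real.sqrt w)⁻¹ := by
  have : 0 < Real.sqrt w := Real.sqrt_pos.2 (by linarith [h.ten_le])
  positivity

theorem differentiableOn_groundFunction (h : IsGaussianFrequency w) (x : ℝ) :
    DifferentiableOn ℂ (fun z => groundFunction z x) (Metric.ball (w : ℂ) (1 / 8)) := by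
  refine DifferentiableOn.mul (h.differentiableOn_groundIntegral.cpow_neg_half
    fun z hz => h.lower_pos.trans_le (h.re_groundIntegral_ge hz)) ?_
  exact DifferentiableOn.mul (by fun_prop) ((h.differentiableOn_kummerCorrection x).const_add 1)

/-- The difference splits into a change of normalization and the correction term. Restricting to
`|x| ≤ 1/2` keeps the growth of the correction at about `e^{w/4}`. Of the `w³` in `error_le`, one
power pays for the prefactors `w^{1/4}` and `w^{3/4}`; two remain, enough for second derivatives. -/
theorem norm_groundFunction_sub_le (h : IsGaussianFrequency w)
    (hz : z ∈ Metric.ball (w : ℂ) (1 / 8)) {x : ℝ} (hx : x ^ 2 ≤ 1 / 4) :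
    ‖groundFunction z x - gaussFunction z x‖ ≤ (w ^ 2)⁻¹ := by
  have hw := h.ten_le
  have hw0 : 0 ≤ w := by linarith
  have hq := h.correctionSize_nonneg
  have he := h.integralError_nonneg
  have h1 := norm_cpow_neg_half_sub_le h.lower_pos (h.re_groundIntegral_ge hz)
    (h.re_gaussIntegral_ge hz)
  rw [rpow_quarter_inv_sqrt' hw0] at h1
  have h2 := norm_cpow_neg_half_le h.lower_pos (h.re_groundIntegral_ge hz)
  rw [rpow_quarter_inv_sqrt hw0] at h2
  have h3 := norm_exp_half_le_one (z := z) (by linarith [re_ge_of_mem_ball hz]) x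
  have h4 := h.norm_kummerCorrection_le hz (hx.trans (by norm_num))
  have h4' : ‖kummerCorrection z x‖ ≤ correctionSize w * Real.exp ((w + 1 / 8) / 4) := by
    refine h4.trans ?_
    gcongr
    nlinarith
  have h5 := h.norm_groundIntegral_sub_le hz
  have hw1 : w ^ (1 / 4 : ℝ) ≤ w := by
    simpa using Real.rpow_le_rpow_of_exponent_le (x := w) (by linarith)
      (show (1 / 4 : ℝ) ≤ 1 by norm_num)
  have hw3 : w ^ (3 / 4 : ℝ) ≤ w := by
    simpa using Real.rpow_le_rpow_of_exponent_le (x := w) (by linarith)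
      (show (3 / 4 : ℝ) ≤ 1 by norm_num)
  set S := groundIntegral z ^ ((-(1 / 2) : ℝ) : ℂ)
  set S' := gaussIntegral z ^ ((-(1 / 2) : ℝ) : ℂ)
  have e : groundFunction z x - gaussFunction z x =
      Complex.exp (-(z * x ^ 2 / 2)) * ((S - S') + S * kummerCorrection z x) := by
    simp only [groundFunction, gaussFunction]; ring
  have h6 : ‖(S - S') + S * kummerCorrection z x‖ ≤ 4 * w * integralError w +
      2 * w * (correctionSize w * Real.exp ((w + 1 / 8) / 4)) := by
    refine (norm_add_le _ _).trans ?_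
    rw [norm_mul]
    refine add_le_add (h1.trans ?_) ?_
    · calc _ ≤ 1 / 2 * (8 * w) * integralError w := by gcongr
        _ = _ := by ring
    · exact mul_le_mul (h2.trans (by gcongr)) h4' (norm_nonneg _) (by positivity)
  rw [e, norm_mul]
  refine (mul_le_of_le_one_left (norm_nonneg _) h3).trans (h6.trans ?_)
  rw [← one_div, le_div_iff₀ (by positivity)]
  linarith [h.error_le]

theorem firstEigenfunction_eq_re (h : IsGaussianFrequency w) {v : ℝ}
    (hv : (v : ℂ) ∈ Metric.ball (w : ℂ) (1 / 8)) {x : ℝ} (hx : |x| ≤ 1) :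
    firstEigenfunction v x = (groundFunction v x).re := by
  have hK := h.isKummerZero hv
  have ha := h.ofReal_re_kummerRoot hv
  have hcorr : ∀ x : ℝ, 1 + kummerCorrection v x =
      ((1 + (kummerRoot v).re * kummerQuot (kummerRoot v).re (v * x ^ 2) : ℝ) : ℂ) := by
    intro x
    push_cast
    rw [kummerQuot_ofReal, ha, kummerCorrection]
    push_cast; rfl
  have hsol : ∀ x : ℝ, Complex.exp (-(v * x ^ 2 / 2)) * (1 + kummerCorrection v x) =
      (evenSolution v (kummerRoot v).re x : ℝ) := by
    intro x
    rw [hcorr, evenSolution]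
    push_cast; rfl
  have hint : groundIntegral v =
      ((∫ x in (-1 : ℝ)..1, evenSolution v (kummerRoot v).re x ^ 2 : ℝ) : ℂ) := by
    rw [← intervalIntegral.integral_ofReal, groundIntegral]
    congr 1
    funext x
    push_cast
    rw [← hsol, mul_pow, ← Complex.exp_nat_mul]
    congr 2
    push_cast; ring
  rw [hK.firstEigenfunction_eq hx, groundFunction, hsol, hint,
    ← Complex.ofReal_cpow hK.integral_pos.le, ← Complex.ofReal_mul, Complex.ofReal_re,
    rpow_neg_half_eq hK.integral_pos.le]

theorem contDiffAt_firstEigenfunction (h : IsGaussianFrequency w) {x : ℝ} (hx : |x| ≤ 1)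
    (n : WithTop ℕ∞) : ContDiffAt ℝ n (fun v => firstEigenfunction v x) w :=
  contDiffAt_of_eq_re (by norm_num) (h.differentiableOn_groundFunction x)
    (fun _ hv => h.firstEigenfunction_eq_re hv hx) n

/-- Cauchy's estimate is applied twice: to the Gaussian on the disc of radius `w/40`, which gains
`w^{-k}`, and to the remainder on the disc of radius `1/8`. -/
theorem abs_iteratedDeriv_firstEigenfunction_le (h : IsGaussianFrequency w) {x : ℝ}
    (hx : |x| ≤ 1 / 2) (k : ℕ) :
    |iteratedDeriv k (fun v => firstEigenfunction v x) w| ≤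
      k.factorial * (2 * w ^ (1 / 4 : ℝ)) / (w / 40 / 2) ^ k +
        k.factorial * (w ^ 2)⁻¹ / (1 / 8 / 2) ^ k := by
  have hx1 : |x| ≤ 1 := by linarith
  have hx2 : x ^ 2 ≤ 1 / 4 := by
    rw [← sq_abs]; nlinarith [abs_nonneg x]
  have hw := h.ten_le
  set f₁ : ℝ → ℝ := fun v => (gaussFunction v x).re with hf₁
  set f₂ : ℝ → ℝ := fun v => firstEigenfunction v x - (gaussFunction v x).re with hf₂
  have hd₁ := differentiableOn_gaussFunction hw x
  have hd₂ := (h.differentiableOn_groundFunction x).sub (hd₁.mono h.ball_subset)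
  have he₂ : ∀ v : ℝ, (v : ℂ) ∈ Metric.ball (w : ℂ) (1 / 8) →
      f₂ v = (groundFunction v x - gaussFunction v x).re := by
    intro v hv
    rw [Complex.sub_re, ← h.firstEigenfunction_eq_re hv hx1]
  have hb₁ := abs_iteratedDeriv_le (f := f₁) (by linarith) hd₁ (fun _ _ => rfl)
    (fun z hz => norm_gaussFunction_le hw x hz) k
  have hb₂ := abs_iteratedDeriv_le (f := f₂) (by norm_num) hd₂ he₂
    (fun z hz => h.norm_groundFunction_sub_le hz hx2) k
  have hc₁ := contDiffAt_of_eq_re (f := f₁) (by linarith) hd₁ (fun _ _ => rfl) k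
  have hc₂ := contDiffAt_of_eq_re (f := f₂) (by norm_num) hd₂ he₂ k
  have e : (fun v => firstEigenfunction v x) = f₁ + f₂ := by
    funext v; simp [hf₁, hf₂]
  rw [e, iteratedDeriv_add hc₁ hc₂]
  exact (abs_add_le _ _).trans (add_le_add hb₁ hb₂)

end IsGaussianFrequency

/-! ### Large frequencies satisfy the smallness conditions -/

theorem inv_kummerQuot_le {w : ℝ} (hw : 10 ≤ w) :
    (kummerQuot (0 : ℝ) w)⁻¹ ≤ 3 * Real.sqrt w * Real.exp (-w) := by
  have h := exp_le_sqrt_mul_kummerQuot (s := w) (by linarith)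
  have hG := two_mul_le_kummerQuot (a := 0) (s := w) (by simp) (by norm_num) (by linarith)
  have hG0 : 0 < kummerQuot (0 : ℝ) w := by linarith
  rw [inv_le_iff_one_le_mul₀ hG0, Real.exp_neg]
  have he := Real.exp_pos w
  calc (1 : ℝ) = Real.exp w * (Real.exp w)⁻¹ := (mul_inv_cancel₀ he.ne').symm
    _ ≤ (3 * Real.sqrt w * kummerQuot (0 : ℝ) w) * (Real.exp w)⁻¹ := by gcongr
    _ = _ := by ring

theorem isGaussianFrequency_of_le_exp {w : ℝ} (hw : 10 ≤ w)
    (h : 20000 * w ^ 7 ≤ Real.exp (w / 2)) : IsGaussianFrequency w := by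
  have hw0 : 0 < w := by linarith
  have hG := two_mul_le_kummerQuot (a := 0) (s := w) (by simp) (by norm_num) (by linarith)
  have hG0 : 0 < kummerQuot (0 : ℝ) w := by linarith
  have hsw : Real.sqrt w ≤ w := by
    rw [Real.sqrt_le_left hw0.le]; nlinarith
  have hinv : (kummerQuot (0 : ℝ) w)⁻¹ ≤ 3 * w * Real.exp (-w) :=
    (inv_kummerQuot_le hw).trans (by gcongr)
  have he8 : Real.exp (1 / 8) ≤ 2 := by
    have := Real.exp_bound_div_one_sub_of_interval (x := 1 / 8) (by norm_num) (by norm_num)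
    exact this.trans (by norm_num)
  have hes : Real.exp (w + 1 / 8) ≤ 2 * Real.exp w := by
    rw [Real.exp_add]; nlinarith [Real.exp_pos w]
  -- All exponentials become powers of `p`, so that every condition reduces to a polynomial in `w`
  -- times `p²`, controlled by the hypothesis.
  set p := Real.exp (-(w / 4)) with hp
  have hp0 : 0 < p := Real.exp_pos _
  have hp1 : p ≤ 1 := Real.exp_le_one_iff.2 (by linarith)
  have hpw : Real.exp w * p ^ 4 = 1 := by
    rw [hp, ← Real.exp_nat_mul, ← Real.exp_add]
    simp only [Real.exp_eq_one_iff]; push_cast; ring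
  have hpn : Real.exp (-w) = p ^ 4 := by
    rw [hp, ← Real.exp_nat_mul]; congr 1; push_cast; ring
  have hp2 : 20000 * w ^ 7 * p ^ 2 ≤ 1 := by
    have : Real.exp (w / 2) * p ^ 2 = 1 := by
      rw [hp, ← Real.exp_nat_mul, ← Real.exp_add]
      simp only [Real.exp_eq_one_iff]; push_cast; ring
    rw [← this]; gcongr
  rw [hpn] at hinv
  have hlarge : IsLargeFrequency w := by
    refine ⟨hw, ?_⟩
    have h1 : 64 * ((w + 1 / 8) * (w + 1 / 8 + 1) * Real.exp (w + 1 / 8)) ≤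
        64 * ((2 * w) * (2 * w) * (2 * Real.exp w)) := by
      gcongr <;> linarith
    refine h1.trans ?_
    have h2 : (kummerQuot (0 : ℝ) w)⁻¹ ^ 2 ≤ (3 * w * p ^ 4) ^ 2 := by gcongr
    have h3 : 512 * w ^ 2 * Real.exp w * (kummerQuot (0 : ℝ) w)⁻¹ ^ 2 ≤ 1 := by
      calc _ ≤ 512 * w ^ 2 * Real.exp w * (3 * w * p ^ 4) ^ 2 := by gcongr
        _ = 4608 * w ^ 4 * p ^ 4 * (Real.exp w * p ^ 4) := by ring
        _ = 4608 * w ^ 4 * p ^ 4 := by rw [hpw, mul_one]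
        _ ≤ 20000 * w ^ 7 * p ^ 2 := by
            have : w ^ 4 ≤ w ^ 7 := pow_le_pow_right₀ (by linarith) (by norm_num)
            have : p ^ 4 ≤ p ^ 2 := pow_le_pow_of_le_one hp0.le hp1 (by norm_num)
            gcongr; norm_num
        _ ≤ 1 := hp2
    rw [inv_pow, ← div_eq_mul_inv, div_le_one (by positivity)] at h3
    linarith
  refine ⟨hlarge, ?_⟩
  have hq0 := hlarge.correctionSize_nonneg
  have hq : correctionSize w ≤ 24 * w ^ 2 * p ^ 4 := by
    rw [correctionSize, div_eq_mul_inv]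
    calc _ ≤ 4 * (2 * w) * (3 * w * p ^ 4) := by gcongr; linarith
      _ = _ := by ring
  have he4 : Real.exp ((w + 1 / 8) / 4) * p ≤ 2 := by
    rw [hp, ← Real.exp_add]
    refine le_trans (Real.exp_le_exp.2 ?_) he8
    linarith
  have hη : correctionSize w * Real.exp ((w + 1 / 8) / 4) ≤ 48 * w ^ 2 * p ^ 3 := by
    calc _ ≤ 24 * w ^ 2 * p ^ 4 * Real.exp ((w + 1 / 8) / 4) := by gcongr
      _ = 24 * w ^ 2 * p ^ 3 * (Real.exp ((w + 1 / 8) / 4) * p) := by ring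
      _ ≤ 24 * w ^ 2 * p ^ 3 * 2 := by gcongr
      _ = _ := by ring
  have hε : integralError w ≤ 192 * w ^ 2 * p ^ 4 + 4608 * w ^ 4 * p ^ 4 := by
    unfold integralError
    calc _ ≤ 8 * (24 * w ^ 2 * p ^ 4) + 4 * (24 * w ^ 2 * p ^ 4) ^ 2 * (2 * Real.exp w) := by
          gcongr
      _ = 192 * w ^ 2 * p ^ 4 + 4608 * w ^ 4 * p ^ 4 * (Real.exp w * p ^ 4) := by ring
      _ = _ := by rw [hpw, mul_one]
  have hw24 : w ^ 2 ≤ w ^ 4 := pow_le_pow_right₀ (by linarith) (by norm_num)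
  have hp42 : p ^ 4 ≤ p ^ 2 := pow_le_pow_of_le_one hp0.le hp1 (by norm_num)
  have hp32 : p ^ 3 ≤ p ^ 2 := pow_le_pow_of_le_one hp0.le hp1 (by norm_num)
  have hε' : integralError w ≤ 4800 * (w ^ 4 * p ^ 2) := by
    refine hε.trans ?_
    calc _ ≤ 192 * w ^ 4 * p ^ 2 + 4608 * w ^ 4 * p ^ 2 := by gcongr
      _ = _ := by ring
  have hη' : correctionSize w * Real.exp ((w + 1 / 8) / 4) ≤ 48 * (w ^ 4 * p ^ 2) := by
    refine hη.trans ?_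
    calc _ ≤ 48 * w ^ 4 * p ^ 2 := by gcongr
      _ = _ := by ring
  calc _ ≤ w ^ 3 * (4 * (4800 * (w ^ 4 * p ^ 2)) + 2 * (48 * (w ^ 4 * p ^ 2))) := by gcongr
    _ = 19296 * (w ^ 7 * p ^ 2) := by ring
    _ ≤ 20000 * w ^ 7 * p ^ 2 := by nlinarith [show 0 ≤ w ^ 7 * p ^ 2 by positivity]
    _ ≤ 1 := hp2

theorem eventually_pow_le_exp_half :
    ∀ᶠ w : ℝ in Filter.atTop, 20000 * w ^ 7 ≤ Real.exp (w / 2) := by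
  have h1 := (Real.tendsto_pow_mul_exp_neg_atTop_nhds_zero 7).comp
    (Filter.tendsto_id.atTop_div_const (show (0 : ℝ) < 2 by norm_num))
  filter_upwards [h1.eventually_lt_const (show (0 : ℝ) < 1 / (20000 * 128) by norm_num)] with w hw
  simp only [Function.comp_apply, id_eq] at hw
  have he : Real.exp (-(w / 2)) * Real.exp (w / 2) = 1 := by
    rw [← Real.exp_add]; simp
  have h2 := mul_le_mul_of_nonneg_right hw.le (Real.exp_pos (w / 2)).le
  rw [mul_assoc, he, mul_one] at h2
  have e : (w / 2) ^ 7 = w ^ 7 / 128 := by ring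
  rw [e] at h2
  linarith

theorem le_exp_div_ten {w : ℝ} (hw : 10 ≤ w) (h : 20000 * w ^ 7 ≤ Real.exp (w / 2)) :
    w ≤ Real.exp (w / 10) := by
  refine le_of_pow_le_pow_left₀ (n := 5) (by norm_num) (Real.exp_pos _).le ?_
  rw [← Real.exp_nat_mul, show ((5 : ℕ) : ℝ) * (w / 10) = w / 2 by push_cast; ring]
  have h1 : w ^ 5 ≤ w ^ 7 := pow_le_pow_right₀ (by linarith) (by norm_num)
  have h2 : 0 ≤ w ^ 7 := by positivity
  linarith

/-! ### Derivatives in the frequency, and the final assembly -/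

namespace IsLargeFrequency

variable {w : ℝ}

theorem isKummerZero_self (h : IsLargeFrequency w) : IsKummerZero w (kummerRoot w).re :=
  h.isKummerZero (Metric.mem_ball_self (by norm_num))

theorem eigenvalueDefect_eq_re (h : IsLargeFrequency w) {v : ℝ}
    (hv : (v : ℂ) ∈ Metric.ball (w : ℂ) (1 / 8)) :
    eigenvalueDefect v = (((-4 : ℝ) : ℂ) * kummerRoot v).re := by
  have hK := h.isKummerZero hv
  rw [eigenvalueDefect, hK.firstEigenvalue_eq, Complex.re_ofReal_mul,
    mul_div_cancel_left₀ _ hK.pos.ne']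
  ring

theorem firstEigenvalue_sub_eq_re (h : IsLargeFrequency w) {v : ℝ}
    (hv : (v : ℂ) ∈ Metric.ball (w : ℂ) (1 / 8)) :
    firstEigenvalue v - v = (((-4 : ℝ) : ℂ) * ((v : ℂ) * kummerRoot v)).re := by
  have hK := h.isKummerZero hv
  rw [hK.firstEigenvalue_eq, Complex.re_ofReal_mul, Complex.re_ofReal_mul]
  ring

theorem two_div_le (h : IsLargeFrequency w) :
    2 / kummerQuot (0 : ℝ) w ≤ 6 * Real.sqrt w * Real.exp (-w) := by
  rw [div_eq_mul_inv]
  linarith [inv_kummerQuot_le h.ten_le]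

theorem abs_iteratedDeriv_eigenvalueDefect_le (h : IsLargeFrequency w) (k : ℕ) :
    |iteratedDeriv k eigenvalueDefect w| ≤
      k.factorial * 16 ^ k * 24 * (Real.sqrt w * Real.exp (-w)) := by
  have h1 := abs_iteratedDeriv_le (by norm_num) (h.differentiableOn_kummerRoot.const_mul _)
    (fun _ hv => h.eigenvalueDefect_eq_re hv) (B := 4 * (6 * Real.sqrt w * Real.exp (-w)))
    (fun z hz => by
      rw [norm_mul, Complex.norm_real, Real.norm_eq_abs, show |(-4 : ℝ)| = 4 by norm_num]
      exact mul_le_mul_of_nonneg_left ((h.norm_kummerRoot_le hz).trans h.two_div_le)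
        (by norm_num)) k
  refine h1.trans (le_of_eq ?_)
  rw [show (1 / 8 / 2 : ℝ) = 16⁻¹ by norm_num, inv_pow, div_inv_eq_mul]
  ring

theorem differentiableOn_mul_kummerRoot (h : IsLargeFrequency w) :
    DifferentiableOn ℂ (fun z => ((-4 : ℝ) : ℂ) * (z * kummerRoot z))
      (Metric.ball (w : ℂ) (1 / 8)) :=
  (differentiableOn_id.mul h.differentiableOn_kummerRoot).const_mul _

theorem contDiffAt_firstEigenvalue_sub (h : IsLargeFrequency w) (n : WithTop ℕ∞) :
    ContDiffAt ℝ n (fun v => firstEigenvalue v - v) w :=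
  contDiffAt_of_eq_re (by norm_num) h.differentiableOn_mul_kummerRoot
    (fun _ hv => h.firstEigenvalue_sub_eq_re hv) n

theorem contDiffAt_firstEigenvalue (h : IsLargeFrequency w) (n : WithTop ℕ∞) :
    ContDiffAt ℝ n firstEigenvalue w := by
  have := (h.contDiffAt_firstEigenvalue_sub n).add contDiffAt_id
  refine this.congr_of_eventuallyEq (Filter.Eventually.of_forall fun v => ?_)
  simp

/-- Here `λ(v) - v` extends holomorphically as `-4 z a(z)`, of size `w · √w e^{-w}`; the factor
`16^k` comes from Cauchy radius `1/16`. -/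
theorem abs_iteratedDeriv_firstEigenvalue_sub_le (h : IsLargeFrequency w) (k : ℕ) :
    |iteratedDeriv k (fun v => firstEigenvalue v - v) w| ≤
      k.factorial * 16 ^ k * 48 * (w ^ (3 / 2 : ℝ) * Real.exp (-w)) := by
  have hw := h.ten_le
  have h1 := abs_iteratedDeriv_le (by norm_num) h.differentiableOn_mul_kummerRoot
    (fun _ hv => h.firstEigenvalue_sub_eq_re hv)
    (B := 4 * ((2 * w) * (6 * Real.sqrt w * Real.exp (-w))))
    (fun z hz => by
      rw [norm_mul, norm_mul, Complex.norm_real, Real.norm_eq_abs,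
        show |(-4 : ℝ)| = 4 by norm_num]
      refine mul_le_mul_of_nonneg_left (mul_le_mul ((h.norm_le hz).trans (by linarith))
        ((h.norm_kummerRoot_le hz).trans h.two_div_le) (norm_nonneg _) (by linarith))
        (by norm_num)) k
  refine h1.trans (le_of_eq ?_)
  have e : w ^ (3 / 2 : ℝ) = w * Real.sqrt w := by
    rw [Real.sqrt_eq_rpow, show (3 / 2 : ℝ) = 1 + 1 / 2 by norm_num,
      Real.rpow_add (by linarith), Real.rpow_one]
  rw [show (1 / 8 / 2 : ℝ) = 16⁻¹ by norm_num, inv_pow, div_inv_eq_mul, e]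
  ring

theorem iteratedDeriv_firstEigenvalue (h : IsLargeFrequency w) {k : ℕ} (hk : 2 ≤ k) :
    iteratedDeriv k firstEigenvalue w = iteratedDeriv k (fun v => firstEigenvalue v - v) w := by
  have h1 := iteratedDeriv_linear_add (h.contDiffAt_firstEigenvalue_sub ∞) 1 1 hk
  rw [one_mul] at h1
  rw [← h1]
  congr 1
  funext v; ring

theorem iteratedDeriv_phase (h : IsLargeFrequency w) {k : ℕ} (hk : 2 ≤ k) (m : ℕ) (t y : ℝ) :
    iteratedDeriv k (fun v => phase m t y v) w =
      -t * iteratedDeriv k (fun v => firstEigenvalue v - v) w := by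
  rw [← iteratedDeriv_linear_add (h.contDiffAt_firstEigenvalue_sub ∞)
    (y - t - 2 * Real.pi * m) (-t) hk]
  congr 1
  funext v
  unfold phase; ring

end IsLargeFrequency

theorem IsGaussianFrequency.abs_iteratedDeriv_firstEigenfunction_le_rpow {w : ℝ}
    (h : IsGaussianFrequency w) {x : ℝ} (hx : |x| ≤ 1 / 2) {k : ℕ} (hk : k = 1 ∨ k = 2) :
    |iteratedDeriv k (fun v => firstEigenfunction v x) w| ≤ 30000 * w ^ (1 / 4 - k : ℝ) := by
  have hw := h.ten_le
  have hw0 : 0 < w := by linarith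
  refine (h.abs_iteratedDeriv_firstEigenfunction_le hx k).trans ?_
  have h1 : w ^ (1 / 4 - k : ℝ) = w ^ (1 / 4 : ℝ) / w ^ k := by
    rw [Real.rpow_sub hw0, Real.rpow_natCast]
  have h2 : (w ^ 2)⁻¹ ≤ w ^ (1 / 4 : ℝ) / w ^ k := by
    have h3 : 1 ≤ w ^ (1 / 4 : ℝ) := Real.one_le_rpow (by linarith) (by norm_num)
    have h4 : w ^ k ≤ w ^ 2 := pow_le_pow_right₀ (by linarith) (by omega)
    rw [← one_div]
    gcongr
  have h5 : 0 ≤ w ^ (1 / 4 : ℝ) / w ^ k := by positivity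
  have h6 : (k.factorial : ℝ) * (2 * w ^ (1 / 4 : ℝ)) / (w / 40 / 2) ^ k =
      k.factorial * 2 * 80 ^ k * (w ^ (1 / 4 : ℝ) / w ^ k) := by
    rw [show w / 40 / 2 = w / 80 by ring, div_pow]
    field_simp
  have h7 : (k.factorial : ℝ) * (w ^ 2)⁻¹ / (1 / 8 / 2) ^ k ≤
      k.factorial * 16 ^ k * (w ^ (1 / 4 : ℝ) / w ^ k) := by
    rw [show (1 / 8 / 2 : ℝ) = 16⁻¹ by norm_num, inv_pow, div_inv_eq_mul]
    calc _ = k.factorial * 16 ^ k * (w ^ 2)⁻¹ := by ring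
      _ ≤ _ := by gcongr
  rw [h6, h1]
  refine (add_le_add le_rfl h7).trans ?_
  rw [← add_mul]
  refine mul_le_mul_of_nonneg_right ?_ h5
  rcases hk with rfl | rfl <;> norm_num [Nat.factorial]

theorem mainTheorem4 :
    ∃ w₀ C₀ C c : ℝ, ∃ A K : ℕ → ℝ,
      0 < w₀ ∧ 0 < C₀ ∧ 0 < C ∧ 0 < c ∧ (∀ k, 0 < A k) ∧ (∀ k, 0 < K k) ∧
      ∀ w : ℝ, w₀ ≤ w →
        -- the objects exist and the derivatives below are genuine
        IsLeast (dirichletEigenvalues w) (firstEigenvalue w) ∧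
        IsFirstEigenfunction w (firstEigenfunction w) ∧
        ContDiffAt ℝ ∞ firstEigenvalue w ∧
        (∀ x : ℝ, |x| ≤ 1 / 2 → ContDiffAt ℝ 2 (fun v => firstEigenfunction v x) w) ∧
        -- (1)
        |firstEigenvalue w - w| ≤ C₀ * w ^ (3 / 2 : ℝ) * Real.exp (-w) ∧
        (∀ k : ℕ, |iteratedDeriv k eigenvalueDefect w| ≤ K k * w ^ A k * Real.exp (-w)) ∧
        -- (2)
        (∀ k : ℕ, 2 ≤ k →
          |iteratedDeriv k firstEigenvalue w| ≤ K k * w ^ A k * Real.exp (-w)) ∧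
        -- (3)
        (∀ k : ℕ, 2 ≤ k → ∀ (m : ℕ) (t y : ℝ),
          |iteratedDeriv k (fun v => phase m t y v) w| ≤
            C₀ * (1 + |t|) * w ^ A k * Real.exp (-w)) ∧
        -- (4)
        (∀ x : ℝ, |x| ≤ 1 / 2 →
          c * w ^ (1 / 4 : ℝ) * Real.exp (-(w * x ^ 2 / 2)) ≤ |firstEigenfunction w x| ∧
          |firstEigenfunction w x| ≤ w ^ (1 / 4 : ℝ) * Real.exp (-(w * x ^ 2 / 2)) ∧
          ∀ k : ℕ, k = 1 ∨ k = 2 →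
            |iteratedDeriv k (fun v => firstEigenfunction v x) w| ≤
              C * w ^ (1 / 4 - k : ℝ)) ∧
        -- (5)
        (∀ x : ℝ, 1 / 2 < |x| → |x| ≤ 1 →
          |firstEigenfunction w x| ≤ Real.exp (-(w / 10))) := by

  obtain ⟨w₁, hw₁⟩ := Filter.eventually_atTop.1 eventually_pow_le_exp_half
  -- The constant in (3) must not depend on `k`, so the Cauchy factor `k! 16^k` is hidden in the
  -- exponent: `A k` exceeds `3/2` by that integer `n`, and `n ≤ 2^n ≤ w^n`.
  refine ⟨max w₁ 10, 48, 30000, 1 / 2, fun k => 3 / 2 + (k.factorial * 16 ^ k : ℕ),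
    fun k => k.factorial * 16 ^ k * 48, by positivity, by norm_num, by norm_num, by norm_num,
    fun k => by positivity, fun k => by positivity, fun w hw => ?_⟩
  have hw10 : 10 ≤ w := (le_max_right _ _).trans hw
  have hw0 : 0 < w := by linarith
  have hexp := hw₁ w ((le_max_left _ _).trans hw)
  have hg := isGaussianFrequency_of_le_exp hw10 hexp
  have hl := hg.toIsLargeFrequency
  have hK := hl.isKummerZero_self
  have hpow : ∀ k : ℕ, w ^ (3 / 2 + (k.factorial * 16 ^ k : ℕ) : ℝ) =
      w ^ (3 / 2 : ℝ) * w ^ (k.factorial * 16 ^ k) := fun k => by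
    rw [Real.rpow_add hw0, Real.rpow_natCast]
  have hge : ∀ k : ℕ, (k.factorial * 16 ^ k : ℝ) ≤ w ^ (k.factorial * 16 ^ k) := fun k => by
    have h1 : ((k.factorial * 16 ^ k : ℕ) : ℝ) ≤ 2 ^ (k.factorial * 16 ^ k) := by
      exact_mod_cast Nat.lt_two_pow_self.le
    push_cast at h1
    exact h1.trans (pow_le_pow_left₀ (by norm_num) (by linarith) _)
  have hle : ∀ k : ℕ, w ^ (3 / 2 : ℝ) ≤ w ^ (3 / 2 + (k.factorial * 16 ^ k : ℕ) : ℝ) := fun k =>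
    Real.rpow_le_rpow_of_exponent_le (by linarith) (le_add_of_nonneg_right (by positivity))
  have hb := hl.abs_iteratedDeriv_firstEigenvalue_sub_le
  refine ⟨?_, hK.isFirstEigenfunction, hl.contDiffAt_firstEigenvalue _,
    fun x hx => hg.contDiffAt_firstEigenfunction (hx.trans (by norm_num)) _, ?_, fun k => ?_,
    fun k hk => ?_, fun k hk m t y => ?_, fun x hx => ⟨?_, ?_, fun k hk => ?_⟩, fun x hx hx1 => ?_⟩
  · rw [hK.firstEigenvalue_eq]
    exact hK.isLeast
  · have := hb 0
    simpa [mul_assoc] using this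
  · refine (hl.abs_iteratedDeriv_eigenvalueDefect_le k).trans ?_
    have h1 : Real.sqrt w ≤ w ^ (3 / 2 + (k.factorial * 16 ^ k : ℕ) : ℝ) := by
      rw [Real.sqrt_eq_rpow]
      exact (Real.rpow_le_rpow_of_exponent_le (by linarith) (by norm_num)).trans (hle k)
    rw [← mul_assoc]
    gcongr
    exact mul_le_mul_of_nonneg_left (by norm_num) (by positivity)
  · rw [hl.iteratedDeriv_firstEigenvalue hk]
    refine (hb k).trans ?_
    rw [← mul_assoc]
    exact mul_le_mul_of_nonneg_right (mul_le_mul_of_nonneg_left (hle k) (by positivity))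
      (Real.exp_pos _).le
  · rw [hl.iteratedDeriv_phase hk, abs_mul, abs_neg, hpow k]
    calc |t| * |iteratedDeriv k (fun v => firstEigenvalue v - v) w|
        ≤ (1 + |t|) * (k.factorial * 16 ^ k * 48 * (w ^ (3 / 2 : ℝ) * Real.exp (-w))) :=
          mul_le_mul (by linarith) (hb k) (abs_nonneg _) (by positivity)
      _ ≤ (1 + |t|) * (w ^ (k.factorial * 16 ^ k) * 48 * (w ^ (3 / 2 : ℝ) * Real.exp (-w))) := by
          gcongr
          exact hge k
      _ = _ := by ring
  · exact hK.le_abs_firstEigenfunction hx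
  · exact hK.abs_firstEigenfunction_le hw10 (hx.trans (by norm_num))
  · exact hg.abs_iteratedDeriv_firstEigenfunction_le_rpow hx hk
  · exact hK.abs_firstEigenfunction_le_exp hw10 (le_exp_div_ten hw10 hexp) hx hx1
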